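/- Let $(\Omega,\mathcal F,P)$ be a probability space. \textbf{Setting.} Let $\varphi:\mathbb R\to\mathbb R$ be an Orlicz N-function, i.e. continuous, even, convex, $\varphi(0)=0$, $\varphi(x)>0$ for $x\ne0$, $\varphi(x)/x\to0$ as $x\to0$ and $\varphi(x)/x\to\infty$ as $x\to\infty$; assume that $\liminf_{x\to0}\varphi(x)/x^2>0$ (possibly $+\infty$). Put $\varphi^*(x)=\sup_{y\in\mathbb R}(xy-\varphi(y))$ and $\Psi(v)=v/\varphi^{(-1)}(v)$ for $v>0$, $\Psi(0)=0$, where $\varphi^{(-1)}$ is the inverse of $\varphi$ on $[0,\infty)$. The space $\mathrm{Sub}_\varphi(\Omega)$ consists of the random variables $\zeta$ with $E\zeta=0$, $Ee^{\lambda\zeta}<\infty$ for all $\lambda\in\mathbb R$, and $Ee^{\lambda\zeta}\le e^{\varphi(a\lambda)}$ for all $\lambda\in\mathbb R$ and some $a>0$; $\tau_\varphi(\zeta)$ is the infimum of all such $a$. A process $y$ is strictly $\varphi$-sub-Gaussian with determining constant $C$ if its values lie in $\mathrm{Sub}_\varphi(\Omega)$ and $\tau_\varphi(\zeta)\le C(E\zeta^2)^{1/2}$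 for every finite linear combination $\zeta$ of them (by closure in mean square, the inequality then also holds for countable sums converging in mean square). Let $Z:[0,\infty)\to\mathbb R$ be an admissible function for $\mathrm{Sub}_\varphi(\Omega)$ with constant $u_0\ge0$: $Z$ is continuous, strictly increasing, unbounded, $Z(u)>0$ for $u>0$, the function $u/Z(u)$ is non-decreasing for $u>u_0$, and for some $\varepsilon>0$ the integral $\int_0^\varepsilon\Psi\big(\ln(Z^{(-1)}(1/s)-u_0)\big)\,ds$ converges, where $Z^{(-1)}$ is the inverse of $Z$. Let $y=\{y(\lambda),\lambda\in\mathbb R\}$ be a real strictly $\varphi$-sub-Gaussian process with determining constant $C_y$ whose covariance function $\Gamma_y(\lambda,\mu)=Ey(\lambda)y(\mu)$ has finite variation on $\mathbb R^2$. For a continuous $g\ge 0$ on $\mathbb R^2$, $\iint g\,d|\Gamma_y|$ denotes the limit along refinement of the grid sums $\sum_{i,j} g\,|\Delta_i\Delta_j\Gamma_y|$. Let $\kappa=\cos$ or $\kappa=\sin$, let $a_1,\dots,a_N$ be real constants, put $p(\lambda)=\sum_{k=1}^N a_k\lambda^{2k+1}(-1)^k$, and let $A>0$ and $V=[-A,A]\times[0,\infty)$.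 Let $$U(t,x)=\int_{-\infty}^{\infty}\kappa\big(\lambda x+t\,p(\lambda)\big)\,dy(\lambda),\qquad (x,t)\in V ,$$ where the integral is a mean-square (improper) Riemann--Stieltjes integral, which is assumed to exist, and assume that $U$ is continuous on $V$ with probability one. \textbf{Assumptions.} The integral $$C_Z^2=\int_{\mathbb R}\int_{\mathbb R}\Big(Z\big(\tfrac{|\lambda|}2+u_0\big)+Z\big(\tfrac{|p(\lambda)|}2+u_0\big)\Big)\Big(Z\big(\tfrac{|\mu|}2+u_0\big)+Z\big(\tfrac{|p(\mu)|}2+u_0\big)\Big)\,d|\Gamma_y(\lambda,\mu)|$$ converges ($C_Z\ge0$), and: \begin{enumerate} \item $0=b_0<b_1<b_2<\dots$ with $b_{k+1}-b_k\ge2A$ for all $k\ge0$, and $V_k=[-A,A]\times[b_k,b_{k+1}]$; \item $c:[0,\infty)\to(0,\infty)$ is continuous, and $c_k=\min_{t\in[b_k,b_{k+1}]}c(t)$; \item $\varepsilon_k=C_y\sup_{(x,t)\in V_k}\big(E|U(t,x)|^2\big)^{1/2}$, and $\sup_{k\ge0}\varepsilon_k/c_k<\infty$; \item $\theta\in(0,1)$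 is such that $\sup_{k\ge0}\hat I_{\varphi,k}(\theta\varepsilon_k)/c_k<\infty$, where $$\hat I_{\varphi,k}(\delta)=\int_0^\delta\Psi\Big(\ln\Big(A\big(Z^{(-1)}(\tfrac{2C_ZC_y}{r})-u_0\big)+1\Big)+\ln\Big(\tfrac{b_{k+1}-b_k}{2}\big(Z^{(-1)}(\tfrac{2C_ZC_y}{r})-u_0\big)+1\Big)\Big)\,dr;$$ \item $s>\sup_{k\ge0}\frac{4\varepsilon_k}{c_k(1-\theta)}$ is such that the series $\sum_{k=0}^\infty\exp\big\{-\varphi^*\big(\frac{s\,c_k(1-\theta)}{2\varepsilon_k}\big)\big\}$ converges (a term with $\varepsilon_k=0$ is read as $0$). \end{enumerate} \textbf{Conclusion.} Let $$A_U(u)=\exp\Big\{-\varphi^*\Big(\frac us\Big)\Big\}\sum_{k=0}^\infty\exp\Big\{-\varphi^*\Big(\frac{s\,c_k(1-\theta)}{2\varepsilon_k}\Big)\Big\}.$$ Then there exists a random variable $\xi$ such that $$P\{\xi>u\}\le2A_U(u)\quad\text{for all } u \text{ with } u>2s \text{ and } u>\sup_{k\ge0}\frac{\hat I_{\varphi,k}(\theta\varepsilon_k)}{c_k}\cdot\frac{4}{\theta(1-\theta)},$$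 and, with probability one, $|U(t,x)|<\xi\,c(t)$ for all $(x,t)\in V$. -/

import Mathlib

open MeasureTheory ProbabilityTheory Filter Topology Set
open scoped ENNReal

noncomputable section

namespace PhiSub

/-! ### Orlicz N-functions -/

/-- `φ` is an Orlicz N-function. -/
structure IsNFunction (φ : ℝ → ℝ) : Prop where
  cont : Continuous φ
  even : ∀ x, φ (-x) = φ x
  convex : ConvexOn ℝ univ φ
  zero : φ 0 = 0
  pos : ∀ x, x ≠ 0 → 0 < φ x
  lim_zero : Tendsto (fun x => φ x / x) (𝓝[≠] 0) (𝓝 0)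
  lim_top : Tendsto (fun x => φ x / x) atTop atTop

/-- Condition Q: `liminf_{x → 0} φ(x) / x² > 0`, the value `∞` being allowed. -/
def ConditionQ (φ : ℝ → ℝ) : Prop :=
  0 < liminf (fun x : ℝ => ((φ x / x ^ 2 : ℝ) : EReal)) (𝓝[≠] 0)

/-- The Young-Fenchel transform `φ*(x) = sup_y (x y - φ(y))`. -/
def youngConj (φ : ℝ → ℝ) (x : ℝ) : ℝ := ⨆ y : ℝ, (x * y - φ y)

/-- The inverse on `[0, ∞)` of a continuous strictly increasing unbounded function `f` on
`[0, ∞)`: for `v ≥ f 0` it is the unique `x ≥ 0` with `f x = v`. -/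
def incInv (f : ℝ → ℝ) (v : ℝ) : ℝ := sInf {x : ℝ | 0 ≤ x ∧ v ≤ f x}

/-- `Ψ(v) = v / φ⁻¹(v)`. -/
def Psi (φ : ℝ → ℝ) (v : ℝ) : ℝ := v / incInv φ v

/-! ### `φ`-sub-Gaussian random variables and processes -/

section Prob

variable {Ω : Type*} [MeasurableSpace Ω]

/-- `ζ` belongs to the space `Sub_φ(Ω)`. -/
structure MemSub (φ : ℝ → ℝ) (P : Measure Ω) (ζ : Ω → ℝ) : Prop where
  aemeas : AEMeasurable ζ P
  mean_zero : ∫ ω, ζ ω ∂P = 0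
  integrable_exp : ∀ l : ℝ, Integrable (fun ω => Real.exp (l * ζ ω)) P
  bound : ∃ a : ℝ, 0 < a ∧ ∀ l : ℝ, ∫ ω, Real.exp (l * ζ ω) ∂P ≤ Real.exp (φ (a * l))

/-- The `φ`-sub-Gaussian standard `τ_φ(ζ)` of a random variable `ζ` in `Sub_φ(Ω)`. -/
def tau (φ : ℝ → ℝ) (P : Measure Ω) (ζ : Ω → ℝ) : ℝ :=
  sInf {a : ℝ | 0 < a ∧ ∀ l : ℝ, ∫ ω, Real.exp (l * ζ ω) ∂P ≤ Real.exp (φ (a * l))}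

/-- The process `y` is strictly `φ`-sub-Gaussian with determining constant `C`: its values lie in
`Sub_φ(Ω)` and `τ_φ(∑ lᵢ y(uᵢ)) ≤ C (E (∑ lᵢ y(uᵢ))²)^{1/2}`. It is enough to ask this of finite
sums: the inequality passes to limits in mean square, in particular to countable sums. -/
def IsStrictlySub {T : Type*} (φ : ℝ → ℝ) (P : Measure Ω) (y : T → Ω → ℝ) (C : ℝ) : Prop :=
  (∀ u, MemSub φ P (y u)) ∧
    ∀ (I : Finset T) (l : T → ℝ),
      tau φ P (fun ω => ∑ u ∈ I, l u * y u ω) ≤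
        C * Real.sqrt (∫ ω, (∑ u ∈ I, l u * y u ω) ^ 2 ∂P)

/-- The covariance function `Γ_y(u, v) = E y(u) y(v)` (of a centred process). -/
def covFun (P : Measure Ω) (y : ℝ → Ω → ℝ) (u v : ℝ) : ℝ := ∫ ω, y u ω * y v ω ∂P

/-! ### Mean-square Stieltjes integrals -/

/-- `X = ∫_a^b f(u) dy(u)`: the Riemann-Stieltjes sums over tagged partitions of `[a, b]` converge
to `X` in mean square as the mesh tends to zero. -/
def HasMSIntegralOn (P : Measure Ω) (y : ℝ → Ω → ℝ) (f : ℝ → ℝ) (a b : ℝ) (X : Ω → ℝ) : Prop :=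
  MemLp X 2 P ∧
    ∀ ε : ℝ≥0∞, 0 < ε → ∃ δ : ℝ, 0 < δ ∧
      ∀ (n : ℕ) (p r : ℕ → ℝ), p 0 = a → p n = b →
        (∀ i < n, p i ≤ p (i + 1) ∧ p (i + 1) - p i < δ ∧ r i ∈ Icc (p i) (p (i + 1))) →
        eLpNorm (fun ω => (∑ i ∈ Finset.range n, f (r i) * (y (p (i + 1)) ω - y (p i) ω)) - X ω)
          2 P < ε

/-- `X = ∫_ℝ f(u) dy(u)`: the mean-square limit of `∫_a^b f(u) dy(u)` as `a → -∞`, `b → ∞`. -/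
def HasMSIntegral (P : Measure Ω) (y : ℝ → Ω → ℝ) (f : ℝ → ℝ) (X : Ω → ℝ) : Prop :=
  MemLp X 2 P ∧
    ∃ J : ℝ → ℝ → Ω → ℝ, (∀ a b, a ≤ b → HasMSIntegralOn P y f a b (J a b)) ∧
      Tendsto (fun q : ℝ × ℝ => eLpNorm (fun ω => J q.1 q.2 ω - X ω) 2 P)
        (atBot ×ˢ atTop) (𝓝 0)

end Prob

/-! ### Integrals with respect to the variation of a function of two variables -/

/-- The increment of `G` over the rectangle `[a, b] × [c, d]`. -/
def rectIncr (G : ℝ → ℝ → ℝ) (a b c d : ℝ) : ℝ := G b d - G a d - G b c + G a c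

/-- `∫∫ g(u, v) |dG(u, v)|` for `g ≥ 0`: the supremum over all finite grids of the lower sums
`∑ᵢ ∑ⱼ (inf g over the cell (i, j)) |ΔᵢΔⱼ G|`. These lower sums increase when the grid is refined;
for continuous `g` and `G` of bounded variation, the supremum is therefore the limit, along
refinement, of the sums `∑ᵢ ∑ⱼ g |ΔᵢΔⱼ G|` with arbitrary points of evaluation in the cells. -/
def varIntegral (G : ℝ → ℝ → ℝ) (g : ℝ → ℝ → ℝ) : ℝ≥0∞ :=
  ⨆ (n : ℕ) (m : ℕ) (p : ℕ → ℝ) (q : ℕ → ℝ) (_ : Monotone p) (_ : Monotone q),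
    ∑ i ∈ Finset.range n, ∑ j ∈ Finset.range m,
      (⨅ (u ∈ Icc (p i) (p (i + 1))) (v ∈ Icc (q j) (q (j + 1))), ENNReal.ofReal (g u v)) *
        ENNReal.ofReal |rectIncr G (p i) (p (i + 1)) (q j) (q (j + 1))|

/-- `G` has finite variation on the plane. -/
def FiniteVariation (G : ℝ → ℝ → ℝ) : Prop := varIntegral G (fun _ _ => 1) ≠ ⊤

/-! ### Admissible functions -/

/-- `Z` (with constant `u₀`) is admissible for the space `Sub_φ(Ω)`. That `Z` is unbounded is
implicit in the use of `Z⁻¹(1 / s)` for all small `s > 0`. -/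
structure IsAdmissible (φ Z : ℝ → ℝ) (u₀ : ℝ) : Prop where
  u₀_nonneg : 0 ≤ u₀
  cont : ContinuousOn Z (Ici 0)
  strictMono : StrictMonoOn Z (Ici 0)
  pos : ∀ u, 0 < u → 0 < Z u
  tendsto : Tendsto Z atTop atTop
  mono_div : MonotoneOn (fun u => u / Z u) (Ioi u₀)
  integrable : ∃ ε : ℝ, 0 < ε ∧
    IntegrableOn (fun s => Psi φ (Real.log (incInv Z (1 / s) - u₀))) (Ioc 0 ε)

/-! ### The field `U` and the quantities attached to it -/

/-- `∑_{k=1}^N a_k λ^{2k+1} (-1)^k`. -/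
def symb (N : ℕ) (a : ℕ → ℝ) (l : ℝ) : ℝ :=
  ∑ k ∈ Finset.Icc 1 N, a k * l ^ (2 * k + 1) * (-1) ^ k

/-- The kernel `I(t, x, λ) = κ(λ x + t ∑_{k=1}^N a_k λ^{2k+1} (-1)^k)`. -/
def kernelI (κ : ℝ → ℝ) (N : ℕ) (a : ℕ → ℝ) (t x l : ℝ) : ℝ := κ (l * x + t * symb N a l)

/-- `Z(|λ|/2 + u₀) + Z(|∑_k a_k λ^{2k+1} (-1)^k|/2 + u₀)`. -/
def weight (Z : ℝ → ℝ) (u₀ : ℝ) (N : ℕ) (a : ℕ → ℝ) (l : ℝ) : ℝ :=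
  Z (|l| / 2 + u₀) + Z (1 / 2 * |symb N a l| + u₀)

/-- The integral `C_Z²`, as an extended non-negative number. -/
def CZsq (G : ℝ → ℝ → ℝ) (Z : ℝ → ℝ) (u₀ : ℝ) (N : ℕ) (a : ℕ → ℝ) : ℝ≥0∞ :=
  varIntegral G (fun l m => weight Z u₀ N a l * weight Z u₀ N a m)

/-- The constant `C_Z`. -/
def CZ (G : ℝ → ℝ → ℝ) (Z : ℝ → ℝ) (u₀ : ℝ) (N : ℕ) (a : ℕ → ℝ) : ℝ :=
  Real.sqrt (CZsq G Z u₀ N a).toReal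

/-- `c_k = min_{t ∈ [b_k, b_{k+1}]} c(t)`. -/
def cmin (c : ℝ → ℝ) (b : ℕ → ℝ) (k : ℕ) : ℝ := sInf (c '' Icc (b k) (b (k + 1)))

/-- `ε_k = C_y sup_{(x, t) ∈ V_k} (E U(t, x)²)^{1/2}`, where `V_k = [-A, A] × [b_k, b_{k+1}]`. -/
def eps {Ω : Type*} [MeasurableSpace Ω] (P : Measure Ω) (U : ℝ → ℝ → Ω → ℝ) (Cy A : ℝ)
    (b : ℕ → ℝ) (k : ℕ) : ℝ :=
  Cy * sSup ((fun q : ℝ × ℝ => Real.sqrt (∫ ω, (U q.2 q.1 ω) ^ 2 ∂P)) ''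
    (Icc (-A) A ×ˢ Icc (b k) (b (k + 1))))

/-- `Î_{φ,k}(δ) = ∫_0^δ Ψ(ln(A (Z⁻¹(2 C_Z C_y / s) - u₀) + 1)
  + ln((b_{k+1} - b_k)/2 (Z⁻¹(2 C_Z C_y / s) - u₀) + 1)) ds`. -/
def Ihat (φ Z : ℝ → ℝ) (u₀ CZ Cy A : ℝ) (b : ℕ → ℝ) (k : ℕ) (δ : ℝ) : ℝ :=
  ∫ s in (0 : ℝ)..δ,
    Psi φ (Real.log (A * (incInv Z (2 * CZ * Cy / s) - u₀) + 1) +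
      Real.log ((b (k + 1) - b k) / 2 * (incInv Z (2 * CZ * Cy / s) - u₀) + 1))

/-- `exp(-φ*(s c_k (1 - θ) / (2 ε_k)))`, read as `exp(-∞) = 0` when `ε_k = 0`. -/
def seriesTerm (φ : ℝ → ℝ) (s θ ck εk : ℝ) : ℝ :=
  open Classical in if εk = 0 then 0 else Real.exp (-youngConj φ (s * ck * (1 - θ) / (2 * εk)))

/-- `A_U(u) = exp(-φ*(u / s)) ∑_{k=0}^∞ exp(-φ*(s c_k (1 - θ) / (2 ε_k)))`. -/
def AU (φ : ℝ → ℝ) (s θ : ℝ) (ck εk : ℕ → ℝ) (u : ℝ) : ℝ :=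
  Real.exp (-youngConj φ (u / s)) * ∑' k, seriesTerm φ s θ (ck k) (εk k)

end PhiSub

end

open PhiSub

open PhiSub

/-! On each rectangle V_k a chaining argument bounds the tail of sup |U|. Superadditivity of φ* then
factors the tail at level u c_k into exp(-φ*(u/s)) times the k-th term of the series, and a union
bound over k finishes.

Input: values and increments of U are mean-square limits of linear combinations of values of y, and
Fatou's lemma carries the strict sub-Gaussian bound to such limits (`IsStrictlySub.expBound`). The
L² size of an increment is controlled through |κ(α) - κ(β)| ≤ 2|sin((α - β)/2)|: for points at
distance at most 1/w in each coordinate, admissibility bounds the kernel difference by 2/Z(w + u₀)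
times the weight (`IsAdmissible.abs_kernelI_sub_le`), and `HasMSIntegral.sqrt_integral_sub_sq_le`
turns this into 2 C_Z / Z(w + u₀).

Chaining: nets of log-cardinality at most H_n are chosen so that the n-th link has sub-Gaussian
constant at most ε θ^n. Jensen's inequality with suitable weights (`measure_exists_gt_le`) gives the
tail 2 exp(φ(lε/(1-θ)) + 2lJ - lu), where J bounds ∑ ε θ^n Ψ(H_n) and may be taken to be the entropy
integral over θ(1-θ). If u ≥ 4J, half of lu absorbs 2lJ, and optimizing over l leaves 2
exp(-φ*(u(1-θ)/(2ε))).

Gluing: at level v c_k the argument of φ* is xz with x = v/s and z = s c_k(1-θ)/(2ε_k). Both are at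
least 2, so xz ≥ x + z and φ* splits. Since s strictly exceeds its lower bound, even z ≥ 2ρ for some
ρ > 1. This slack lets the supremum be multiplied by ρ, which makes the final inequality strict at
no cost in the tail. -/

namespace PhiSub

/-! ### N-functions -/

namespace IsNFunction

variable {φ : ℝ → ℝ}

theorem nonneg (h : IsNFunction φ) (x : ℝ) : 0 ≤ φ x := by
  by_cases hx : x = 0
  · rw [hx, h.zero]
  · exact (h.pos x hx).le

theorem map_abs (h : IsNFunction φ) (x : ℝ) : φ |x| = φ x := by
  rcases abs_choice x with hx | hx <;> rw [hx]
  exact h.even x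

theorem mono (h : IsNFunction φ) {x y : ℝ} (hxy : |x| ≤ |y|) : φ x ≤ φ y := by
  have h1 := h.convex.le_max_of_mem_Icc (mem_univ (-|y|)) (mem_univ |y|) (abs_le.mp hxy)
  rwa [h.even, max_self, h.map_abs] at h1

theorem map_smul_le (h : IsNFunction φ) {t : ℝ} (ht0 : 0 ≤ t) (ht1 : t ≤ 1) (x : ℝ) :
    φ (t * x) ≤ t * φ x := by
  have h1 := h.convex.2 (mem_univ x) (mem_univ (0 : ℝ)) ht0 (sub_nonneg.mpr ht1) (by ring)
  simpa [h.zero] using h1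

theorem tendsto_atTop (h : IsNFunction φ) : Tendsto φ atTop atTop := by
  refine (h.lim_top.atTop_mul_atTop₀ tendsto_id).congr' ?_
  filter_upwards [eventually_gt_atTop 0] with x hx
  simp [div_mul_cancel₀ _ hx.ne']

theorem monotoneOn (h : IsNFunction φ) : MonotoneOn φ (Ici 0) := fun x hx y hy hxy =>
  h.mono (by rwa [abs_of_nonneg hx, abs_of_nonneg hy])

/-- Superlinear growth makes xy - φ(y) nonpositive for |y| > |M|. A real supremum over an unbounded
set would be 0 by default, so every lower bound on `youngConj` rests on this. -/
theorem bddAbove_youngConj (h : IsNFunction φ) (x : ℝ) :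
    BddAbove (range fun y : ℝ => x * y - φ y) := by
  obtain ⟨M, hM⟩ := eventually_atTop.mp (h.lim_top.eventually_ge_atTop |x|)
  refine ⟨|x| * |M|, ?_⟩
  rintro _ ⟨y, rfl⟩
  have h1 : x * y ≤ |x| * |y| := by rw [← abs_mul]; exact le_abs_self _
  simp only
  rcases le_or_gt |y| |M| with hy | hy
  · have := h.nonneg y
    have := mul_le_mul_of_nonneg_left hy (abs_nonneg x)
    linarith
  · have h0 : 0 < |y| := (abs_nonneg M).trans_lt hy
    have h2 := hM |y| ((le_abs_self M).trans hy.le)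
    rw [le_div_iff₀ h0, h.map_abs] at h2
    have := mul_nonneg (abs_nonneg x) (abs_nonneg M)
    linarith

theorem le_youngConj (h : IsNFunction φ) (x y : ℝ) : x * y - φ y ≤ youngConj φ x :=
  le_ciSup (h.bddAbove_youngConj x) y

theorem youngConj_nonneg (h : IsNFunction φ) (x : ℝ) : 0 ≤ youngConj φ x := by
  simpa [h.zero] using h.le_youngConj x 0

/-- Since φ ≥ 0 and t ≤ 1, txy - φ(y) ≤ t(xy - φ(y)). Monotonicity and superadditivity of φ* on the
positive half-line both follow. -/
theorem youngConj_smul_le (h : IsNFunction φ) {t : ℝ} (ht0 : 0 ≤ t) (ht1 : t ≤ 1) (x : ℝ) :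
    youngConj φ (t * x) ≤ t * youngConj φ x := by
  refine ciSup_le fun y => ?_
  have h1 := mul_le_mul_of_nonneg_left (h.le_youngConj x y) ht0
  have h2 := mul_le_mul_of_nonneg_right ht1 (h.nonneg y)
  linarith

theorem youngConj_mono (h : IsNFunction φ) {x y : ℝ} (hx : 0 ≤ x) (hxy : x ≤ y) :
    youngConj φ x ≤ youngConj φ y := by
  rcases (hx.trans hxy).eq_or_lt with hy | hy
  · rw [le_antisymm hxy (hy ▸ hx)]
  · have h1 := h.youngConj_smul_le (div_nonneg hx hy.le) ((div_le_one hy).mpr hxy) y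
    rw [div_mul_cancel₀ _ hy.ne'] at h1
    exact h1.trans (mul_le_of_le_one_left (h.youngConj_nonneg y) ((div_le_one hy).mpr hxy))

/-- Scale x + y by x/(x+y) and by y/(x+y), and add. -/
theorem youngConj_add_le (h : IsNFunction φ) {x y : ℝ} (hx : 0 < x) (hy : 0 < y) :
    youngConj φ x + youngConj φ y ≤ youngConj φ (x + y) := by
  have hxy : 0 < x + y := add_pos hx hy
  have h1 := h.youngConj_smul_le (div_nonneg hx.le hxy.le)
    ((div_le_one hxy).mpr (by linarith)) (x + y)
  have h2 := h.youngConj_smul_le (div_nonneg hy.le hxy.le)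
    ((div_le_one hxy).mpr (by linarith)) (x + y)
  rw [div_mul_cancel₀ _ hxy.ne'] at h1 h2
  calc _ ≤ x / (x + y) * youngConj φ (x + y) + y / (x + y) * youngConj φ (x + y) :=
        add_le_add h1 h2
    _ = youngConj φ (x + y) := by field_simp

theorem tendsto_youngConj (h : IsNFunction φ) : Tendsto (youngConj φ) atTop atTop := by
  refine tendsto_atTop_mono (fun x => h.le_youngConj x 1) ?_
  simp only [mul_one, sub_eq_add_neg]
  exact tendsto_atTop_add_const_right _ _ tendsto_id

end IsNFunction

/-! ### Generalized inverses -/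

section incInv

variable {f : ℝ → ℝ}

theorem incInv_nonneg (f : ℝ → ℝ) (v : ℝ) : 0 ≤ incInv f v :=
  Real.sInf_nonneg fun _ hx => hx.1

theorem bddBelow_incInv (f : ℝ → ℝ) (v : ℝ) : BddBelow {x : ℝ | 0 ≤ x ∧ v ≤ f x} :=
  ⟨0, fun _ hx => hx.1⟩

theorem incInv_le {v x : ℝ} (hx : 0 ≤ x) (hv : v ≤ f x) : incInv f v ≤ x :=
  csInf_le (bddBelow_incInv f v) ⟨hx, hv⟩

theorem incInv_nonempty (hf : Tendsto f atTop atTop) (v : ℝ) :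
    {x : ℝ | 0 ≤ x ∧ v ≤ f x}.Nonempty := by
  obtain ⟨x, h1, h2⟩ := ((hf.eventually_ge_atTop v).and (eventually_ge_atTop 0)).exists
  exact ⟨x, h2, h1⟩

theorem monotone_incInv (hf : Tendsto f atTop atTop) : Monotone (incInv f) := fun v w hvw =>
  csInf_le_csInf (bddBelow_incInv f v) (incInv_nonempty hf w) fun _ hx => ⟨hx.1, hvw.trans hx.2⟩

theorem le_apply_incInv (hc : ContinuousOn f (Ici 0)) (hf : Tendsto f atTop atTop) (v : ℝ) :
    v ≤ f (incInv f v) := by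
  have hcl : IsClosed {x : ℝ | 0 ≤ x ∧ v ≤ f x} := by
    have := hc.preimage_isClosed_of_isClosed isClosed_Ici (isClosed_Ici (a := v))
    exact this
  exact (hcl.csInf_mem (incInv_nonempty hf v) (bddBelow_incInv f v)).2

/-- To the left of the infimum f < v, and continuity passes this to the infimum. Its positivity
guarantees that there are such points in [0, ∞). -/
theorem apply_incInv_le (hc : ContinuousOn f (Ici 0)) {v : ℝ}
    (hv : 0 < incInv f v) : f (incInv f v) ≤ v := by
  have h1 : Tendsto f (𝓝[Ico 0 (incInv f v)] (incInv f v)) (𝓝 (f (incInv f v))) :=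
    (hc _ hv.le).mono_left (nhdsWithin_mono _ fun x hx => hx.1)
  have : (𝓝[Ico 0 (incInv f v)] (incInv f v)).NeBot := by
    rw [← mem_closure_iff_nhdsWithin_neBot, closure_Ico hv.ne]
    exact ⟨hv.le, le_rfl⟩
  refine le_of_tendsto h1 ?_
  filter_upwards [self_mem_nhdsWithin] with x hx
  by_contra! hlt
  exact absurd (incInv_le hx.1 hlt.le) (not_le.mpr hx.2)

theorem le_incInv (hf : Tendsto f atTop atTop) (hm : MonotoneOn f (Ici 0)) {v x : ℝ}
    (hx : 0 ≤ x) (hv : f x < v) : x ≤ incInv f v := by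
  refine le_csInf (incInv_nonempty hf v) fun z hz => ?_
  by_contra! hlt
  exact absurd (hm hz.1 hx hlt.le) (not_le.mpr (hv.trans_le hz.2))

end incInv

/-! ### The function `Ψ` -/

namespace IsNFunction

variable {φ : ℝ → ℝ}

theorem incInv_eq_zero (h : IsNFunction φ) {v : ℝ} (hv : v ≤ 0) : incInv φ v = 0 :=
  le_antisymm (incInv_le le_rfl (by rwa [h.zero])) (incInv_nonneg _ _)

theorem le_apply_incInv (h : IsNFunction φ) (v : ℝ) : v ≤ φ (incInv φ v) :=
  PhiSub.le_apply_incInv h.cont.continuousOn h.tendsto_atTop v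

theorem incInv_pos (h : IsNFunction φ) {v : ℝ} (hv : 0 < v) : 0 < incInv φ v := by
  refine (incInv_nonneg φ v).lt_of_ne fun h0 => ?_
  have := h.le_apply_incInv v
  rw [← h0, h.zero] at this
  linarith

theorem apply_incInv (h : IsNFunction φ) {v : ℝ} (hv : 0 ≤ v) : φ (incInv φ v) = v := by
  refine le_antisymm ?_ (h.le_apply_incInv v)
  rcases hv.eq_or_lt with rfl | hv
  · rw [h.incInv_eq_zero le_rfl, h.zero]
  · exact apply_incInv_le h.cont.continuousOn (h.incInv_pos hv)

theorem psi_of_nonpos (h : IsNFunction φ) {v : ℝ} (hv : v ≤ 0) : Psi φ v = 0 := by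
  rw [Psi, h.incInv_eq_zero hv, div_zero]

theorem psi_nonneg (h : IsNFunction φ) (v : ℝ) : 0 ≤ Psi φ v := by
  rcases le_total v 0 with hv | hv
  · rw [h.psi_of_nonpos hv]
  · exact div_nonneg hv (incInv_nonneg _ _)

/-- With z = φ⁻¹(v) one has Ψ(v) = φ(z)/z, the slope of a chord from the origin, which is
nondecreasing for a convex function vanishing at 0. -/
theorem monotone_psi (h : IsNFunction φ) : Monotone (Psi φ) := fun v w hvw => by
  rcases le_or_gt v 0 with hv | hv
  · rw [h.psi_of_nonpos hv]; exact h.psi_nonneg w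
  · have hw := hv.trans_le hvw
    have hz := h.incInv_pos hv
    have hz' := h.incInv_pos hw
    have hzz := monotone_incInv h.tendsto_atTop hvw
    have h1 := h.map_smul_le (div_nonneg hz.le hz'.le) ((div_le_one hz').mpr hzz) (incInv φ w)
    rw [div_mul_cancel₀ _ hz'.ne', h.apply_incInv hv.le, h.apply_incInv hw.le] at h1
    rw [Psi, Psi, div_le_iff₀ hz]
    calc v ≤ _ := h1
      _ = _ := by ring

/-- The factor 3 is the exponent in (Aw + 1)(Bw + 1) ≤ w³ for large w, used for integrability of the
entropy integrand near 0. -/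
theorem psi_three_mul_le (h : IsNFunction φ) {v : ℝ} (hv : 0 ≤ v) : Psi φ (3 * v) ≤ 3 * Psi φ v := by
  rcases hv.eq_or_lt with rfl | hv
  · simp [h.psi_of_nonpos le_rfl]
  · rw [Psi, Psi, mul_div_assoc]
    have := monotone_incInv h.tendsto_atTop (show v ≤ 3 * v by linarith)
    have := h.incInv_pos hv
    gcongr

end IsNFunction

/-! ### Exponential bounds -/

variable {Ω : Type*} [MeasurableSpace Ω] {P : Measure Ω} {φ : ℝ → ℝ}

/-- `E exp(l ζ) ≤ exp(φ(a l))` for all `l`. -/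
structure ExpBound (φ : ℝ → ℝ) (P : Measure Ω) (a : ℝ) (ζ : Ω → ℝ) : Prop where
  aemeas : AEMeasurable ζ P
  le : ∀ l : ℝ, ∫⁻ ω, ENNReal.ofReal (Real.exp (l * ζ ω)) ∂P ≤ ENNReal.ofReal (Real.exp (φ (a * l)))

theorem _root_.AEMeasurable.ofReal_exp_mul {ζ : Ω → ℝ} (h : AEMeasurable ζ P) (l : ℝ) :
    AEMeasurable (fun ω => ENNReal.ofReal (Real.exp (l * ζ ω))) P :=
  (Real.measurable_exp.comp_aemeasurable (h.const_mul l)).ennreal_ofReal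

namespace ExpBound

variable {a b : ℝ} {ζ η : Ω → ℝ}

theorem mono (hφ : IsNFunction φ) (h : ExpBound φ P a ζ) (hab : |a| ≤ |b|) : ExpBound φ P b ζ :=
  ⟨h.aemeas, fun l => (h.le l).trans <| ENNReal.ofReal_le_ofReal <| Real.exp_le_exp.mpr <|
    hφ.mono (by rw [abs_mul, abs_mul]; gcongr)⟩

theorem zero [IsProbabilityMeasure P] (hφ : IsNFunction φ) (a : ℝ) :
    ExpBound φ P a (0 : Ω → ℝ) := by
  refine ⟨aemeasurable_const, fun l => ?_⟩
  simpa using hφ.nonneg _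

theorem smul (h : ExpBound φ P a ζ) (c : ℝ) : ExpBound φ P (a * c) (c • ζ) := by
  refine ⟨h.aemeas.const_smul c, fun l => ?_⟩
  have := h.le (l * c)
  simp only [Pi.smul_apply, smul_eq_mul, ← mul_assoc]
  rwa [mul_assoc a, mul_comm c l]

/-- Write l(ζ + η) as the convex combination of (l/p)ζ and (l/q)η with p = a/(a+b), q = b/(a+b).
Then a·l/p = b·l/q = (a+b)l, so both terms obey the same bound; independence plays no role. -/
theorem add (h : ExpBound φ P a ζ) (h' : ExpBound φ P b η) (ha : 0 < a) (hb : 0 < b) :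
    ExpBound φ P (a + b) (ζ + η) := by
  refine ⟨h.aemeas.add h'.aemeas, fun l => ?_⟩
  have hab : 0 < a + b := add_pos ha hb
  set p := a / (a + b) with hp
  set q := b / (a + b) with hq
  have hp0 : 0 < p := div_pos ha hab
  have hq0 : 0 < q := div_pos hb hab
  have hpq : p + q = 1 := by rw [hp, hq]; field_simp
  have key : ∀ ω, ENNReal.ofReal (Real.exp (l * (ζ + η) ω)) ≤
      ENNReal.ofReal p * ENNReal.ofReal (Real.exp (l / p * ζ ω)) +
        ENNReal.ofReal q * ENNReal.ofReal (Real.exp (l / q * η ω)) := fun ω => by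
    rw [← ENNReal.ofReal_mul hp0.le, ← ENNReal.ofReal_mul hq0.le,
      ← ENNReal.ofReal_add (by positivity) (by positivity)]
    refine ENNReal.ofReal_le_ofReal ?_
    have := convexOn_exp.2 (mem_univ (l / p * ζ ω)) (mem_univ (l / q * η ω)) hp0.le hq0.le hpq
    simp only [smul_eq_mul] at this
    refine le_of_eq_of_le ?_ this
    rw [Pi.add_apply]
    congr 1
    field_simp
  have h1 := h.le (l / p)
  have h2 := h'.le (l / q)
  have e1 : a * (l / p) = (a + b) * l := by rw [hp]; field_simp
  have e2 : b * (l / q) = (a + b) * l := by rw [hq]; field_simp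
  rw [e1] at h1
  rw [e2] at h2
  calc _ ≤ ∫⁻ ω, (ENNReal.ofReal p * ENNReal.ofReal (Real.exp (l / p * ζ ω)) +
        ENNReal.ofReal q * ENNReal.ofReal (Real.exp (l / q * η ω))) ∂P := lintegral_mono key
    _ = ENNReal.ofReal p * (∫⁻ ω, ENNReal.ofReal (Real.exp (l / p * ζ ω)) ∂P) +
        ENNReal.ofReal q * ∫⁻ ω, ENNReal.ofReal (Real.exp (l / q * η ω)) ∂P := by
        rw [lintegral_add_left' ((h.aemeas.ofReal_exp_mul _).const_mul _),
          lintegral_const_mul' _ _ ENNReal.ofReal_ne_top,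
          lintegral_const_mul' _ _ ENNReal.ofReal_ne_top]
    _ ≤ ENNReal.ofReal p * ENNReal.ofReal (Real.exp (φ ((a + b) * l))) +
        ENNReal.ofReal q * ENNReal.ofReal (Real.exp (φ ((a + b) * l))) := by gcongr
    _ = _ := by
        rw [← add_mul, ← ENNReal.ofReal_add hp0.le hq0.le, hpq, ENNReal.ofReal_one, one_mul]

/-- The bound with `a = 0` forces the variable to vanish. -/
theorem ae_eq_zero [IsProbabilityMeasure P] (hφ : IsNFunction φ) (h : ExpBound φ P 0 ζ) :
    ζ =ᵐ[P] 0 := by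
  have hm1 := h.aemeas.ofReal_exp_mul 1
  have h1 := h.le 1
  have h2 := h.le (-1)
  simp only [zero_mul, hφ.zero, Real.exp_zero, ENNReal.ofReal_one] at h1 h2
  -- The function e^x + e^{-x} is at least 2, with equality only at 0, while its expectation is at
  -- most 2. Hence equality holds almost surely.
  have hle : ∀ ω, (2 : ℝ≥0∞) ≤ ENNReal.ofReal (Real.exp (1 * ζ ω)) +
      ENNReal.ofReal (Real.exp (-1 * ζ ω)) := fun ω => by
    rw [← ENNReal.ofReal_add (by positivity) (by positivity),
      show (2 : ℝ≥0∞) = ENNReal.ofReal 2 by simp]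
    refine ENNReal.ofReal_le_ofReal ?_
    have := Real.add_one_le_exp (1 * ζ ω)
    have := Real.add_one_le_exp (-1 * ζ ω)
    linarith
  have hint : ∫⁻ ω, (ENNReal.ofReal (Real.exp (1 * ζ ω)) +
      ENNReal.ofReal (Real.exp (-1 * ζ ω))) ∂P ≤ ∫⁻ _, (2 : ℝ≥0∞) ∂P := by
    rw [lintegral_add_left' hm1, lintegral_const, measure_univ, mul_one, ← one_add_one_eq_two]
    exact add_le_add h1 h2
  have heq := ae_eq_of_ae_le_of_lintegral_le (Eventually.of_forall hle) (by simp)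
    (hm1.add (h.aemeas.ofReal_exp_mul (-1))) hint
  filter_upwards [heq] with ω hω
  by_contra hne
  simp only [Pi.zero_apply] at hne
  rw [← ENNReal.ofReal_add (by positivity) (by positivity),
    show (2 : ℝ≥0∞) = ENNReal.ofReal 2 by simp,
    ENNReal.ofReal_eq_ofReal_iff (by norm_num) (by positivity)] at hω
  have := Real.add_one_lt_exp (x := 1 * ζ ω) (by simpa using hne)
  have := Real.add_one_le_exp (-1 * ζ ω)
  linarith

/-- Fatou's lemma for exponential bounds. -/
theorem of_tendsto (hφ : IsNFunction φ) {Y : ℕ → Ω → ℝ} {α : ℕ → ℝ}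
    (h : ∀ n, ExpBound φ P (α n) (Y n)) (hα : Tendsto α atTop (𝓝 a))
    (hY : ∀ᵐ ω ∂P, Tendsto (fun n => Y n ω) atTop (𝓝 (ζ ω))) : ExpBound φ P a ζ := by
  refine ⟨aemeasurable_of_tendsto_metrizable_ae' (fun n => (h n).aemeas) hY, fun l => ?_⟩
  have h1 : ∀ᵐ ω ∂P, liminf (fun n => ENNReal.ofReal (Real.exp (l * Y n ω))) atTop =
      ENNReal.ofReal (Real.exp (l * ζ ω)) := hY.mono fun ω hω =>
    (ENNReal.tendsto_ofReal ((Real.continuous_exp.tendsto _).comp (hω.const_mul l))).liminf_eq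
  have h2 : liminf (fun n => ENNReal.ofReal (Real.exp (φ (α n * l)))) atTop =
      ENNReal.ofReal (Real.exp (φ (a * l))) :=
    (ENNReal.tendsto_ofReal ((Real.continuous_exp.comp hφ.cont).tendsto _ |>.comp
      (hα.mul_const l))).liminf_eq
  rw [← lintegral_congr_ae h1, ← h2]
  exact (lintegral_liminf_le' fun n => (h n).aemeas.ofReal_exp_mul l).trans
    (liminf_le_liminf (Eventually.of_forall fun n => (h n).le l))

end ExpBound

theorem expBound_of_integral_le {a : ℝ} {ζ : Ω → ℝ} (hζ : AEMeasurable ζ P)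
    (hi : ∀ l : ℝ, Integrable (fun ω => Real.exp (l * ζ ω)) P)
    (h : ∀ l : ℝ, ∫ ω, Real.exp (l * ζ ω) ∂P ≤ Real.exp (φ (a * l))) : ExpBound φ P a ζ :=
  ⟨hζ, fun l => by
    rw [← ofReal_integral_eq_lintegral_ofReal (hi l) (Eventually.of_forall fun _ => by positivity)]
    exact ENNReal.ofReal_le_ofReal (h l)⟩

theorem ExpBound.integral_le {a : ℝ} {ζ : Ω → ℝ} (h : ExpBound φ P a ζ) (l : ℝ) :
    ∫ ω, Real.exp (l * ζ ω) ∂P ≤ Real.exp (φ (a * l)) := by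
  rw [integral_eq_lintegral_of_nonneg_ae (Eventually.of_forall fun _ => by positivity)
    (h.aemeas.const_mul l).exp.aestronglyMeasurable]
  exact ENNReal.toReal_le_of_le_ofReal (by positivity) (h.le l)

theorem ExpBound.integrable {a : ℝ} {ζ : Ω → ℝ} (h : ExpBound φ P a ζ) (l : ℝ) :
    Integrable (fun ω => Real.exp (l * ζ ω)) P := by
  refine ⟨(Real.measurable_exp.comp_aemeasurable (h.aemeas.const_mul l)).aestronglyMeasurable, ?_⟩
  rw [hasFiniteIntegral_iff_ofReal (Eventually.of_forall fun _ => by positivity)]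
  exact (h.le l).trans_lt ENNReal.ofReal_lt_top

theorem MemSub.exists_expBound {ζ : Ω → ℝ} (h : MemSub φ P ζ) :
    ∃ a, 0 < a ∧ ExpBound φ P a ζ := by
  obtain ⟨a, ha, hl⟩ := h.bound
  exact ⟨a, ha, expBound_of_integral_le h.aemeas h.integrable_exp hl⟩

/-- The infimum in the definition of `τ_φ` is attained. -/
theorem expBound_tau (hφ : IsNFunction φ) {ζ : Ω → ℝ} (h : ∃ a, 0 < a ∧ ExpBound φ P a ζ) :
    ExpBound φ P (tau φ P ζ) ζ := by
  obtain ⟨a, ha, hb⟩ := h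
  set S := {a : ℝ | 0 < a ∧ ∀ l : ℝ, ∫ ω, Real.exp (l * ζ ω) ∂P ≤ Real.exp (φ (a * l))} with hS
  have hne : S.Nonempty := ⟨a, ha, hb.integral_le⟩
  have hbdd : BddBelow S := ⟨0, fun x hx => hx.1.le⟩
  obtain ⟨u, -, hu, huS⟩ := exists_seq_tendsto_sInf hne hbdd
  exact ExpBound.of_tendsto hφ
    (fun n => expBound_of_integral_le hb.aemeas hb.integrable (huS n).2) hu
    (Eventually.of_forall fun ω => tendsto_const_nhds)

theorem tau_nonneg (ζ : Ω → ℝ) : 0 ≤ tau φ P ζ := Real.sInf_nonneg fun _ hx => hx.1.le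

theorem MemSub.memLp [IsProbabilityMeasure P] {ζ : Ω → ℝ} (h : MemSub φ P ζ) : MemLp ζ 2 P := by
  have hi : Integrable (fun ω => 2 * (Real.exp (1 * ζ ω) + Real.exp (-1 * ζ ω))) P :=
    ((h.integrable_exp 1).add (h.integrable_exp (-1))).const_mul 2
  rw [memLp_two_iff_integrable_sq h.aemeas.aestronglyMeasurable]
  refine hi.mono' (h.aemeas.pow_const 2).aestronglyMeasurable (Eventually.of_forall fun ω => ?_)
  rw [Real.norm_of_nonneg (sq_nonneg _), one_mul, neg_one_mul]
  have h0 := Real.exp_pos (ζ ω)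
  have h1 := Real.exp_pos (-ζ ω)
  rcases le_total 0 (ζ ω) with h2 | h2
  · have := Real.quadratic_le_exp_of_nonneg h2
    nlinarith
  · have := Real.quadratic_le_exp_of_nonneg (neg_nonneg.mpr h2)
    nlinarith

theorem sqrt_integral_sq {ζ : Ω → ℝ} (h : MemLp ζ 2 P) :
    √(∫ ω, ζ ω ^ 2 ∂P) = (eLpNorm ζ 2 P).toReal := by
  rw [h.eLpNorm_eq_integral_rpow_norm (by norm_num) (by norm_num), ENNReal.toReal_ofReal (by positivity)]
  simp [Real.sqrt_eq_rpow]

/-! ### Strictly sub-Gaussian processes -/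

theorem IsStrictlySub.tau_le_of_mem_span {T : Type*} {y : T → Ω → ℝ} {C : ℝ}
    (hy : IsStrictlySub φ P y C) {ζ : Ω → ℝ}
    (hζ : ζ ∈ Submodule.span ℝ (range y)) : tau φ P ζ ≤ C * √(∫ ω, ζ ω ^ 2 ∂P) := by
  obtain ⟨c, rfl⟩ := Finsupp.mem_span_range_iff_exists_finsupp.mp hζ
  have h := hy.2 c.support c
  have e : (fun ω => ∑ u ∈ c.support, c u * y u ω) = c.sum fun i a => a • y i := by
    ext ω
    simp [Finsupp.sum, Finset.sum_apply]
  have e' : ∀ ω, ∑ u ∈ c.support, c u * y u ω = (c.sum fun i a => a • y i) ω := fun ω =>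
    congrFun e ω
  rw [e] at h
  simpa only [e'] using h

section Strict

variable [IsProbabilityMeasure P] {T : Type*} {y : T → Ω → ℝ} {C : ℝ}

theorem IsStrictlySub.exists_expBound_of_mem_span (hφ : IsNFunction φ)
    (hy : IsStrictlySub φ P y C) {ζ : Ω → ℝ} (hζ : ζ ∈ Submodule.span ℝ (range y)) :
    ∃ a, 0 < a ∧ ExpBound φ P a ζ := by
  induction hζ using Submodule.span_induction with
  | mem x hx => obtain ⟨u, rfl⟩ := hx; exact (hy.1 u).exists_expBound
  | zero => exact ⟨1, one_pos, .zero hφ 1⟩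
  | add x z _ _ hx hz =>
    obtain ⟨a, ha, hxa⟩ := hx
    obtain ⟨b, hb, hzb⟩ := hz
    exact ⟨a + b, add_pos ha hb, hxa.add hzb ha hb⟩
  | smul c x _ hx =>
    obtain ⟨a, ha, hxa⟩ := hx
    rcases eq_or_ne c 0 with rfl | hc
    · exact ⟨1, one_pos, by simpa using ExpBound.zero hφ 1⟩
    · exact ⟨|a * c|, by positivity, (hxa.smul c).mono hφ (abs_abs _).ge⟩

theorem IsStrictlySub.memLp_of_mem_span (hy : IsStrictlySub φ P y C) {ζ : Ω → ℝ}
    (hζ : ζ ∈ Submodule.span ℝ (range y)) : MemLp ζ 2 P := by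
  induction hζ using Submodule.span_induction with
  | mem x hx => obtain ⟨u, rfl⟩ := hx; exact (hy.1 u).memLp
  | zero => exact MemLp.zero'
  | add x z _ _ hx hz => exact hx.add hz
  | smul c x _ hx => exact hx.const_smul c

/-- `X` is a mean-square limit of linear combinations of the values of `y`. -/
def MemMSClosure (P : Measure Ω) (y : T → Ω → ℝ) (X : Ω → ℝ) : Prop :=
  MemLp X 2 P ∧ ∀ ε : ℝ≥0∞, 0 < ε → ∃ ζ ∈ Submodule.span ℝ (range y), eLpNorm (ζ - X) 2 P < ε

theorem MemMSClosure.sub {X X' : Ω → ℝ} (hy : IsStrictlySub φ P y C) (h : MemMSClosure P y X)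
    (h' : MemMSClosure P y X') : MemMSClosure P y (X - X') := by
  refine ⟨h.1.sub h'.1, fun ε hε => ?_⟩
  obtain ⟨ζ, hζ, h1⟩ := h.2 (ε / 2) (ENNReal.half_pos hε.ne')
  obtain ⟨ζ', hζ', h2⟩ := h'.2 (ε / 2) (ENNReal.half_pos hε.ne')
  refine ⟨ζ - ζ', sub_mem hζ hζ', ?_⟩
  have e : ζ - ζ' - (X - X') = (ζ - X) - (ζ' - X') := by abel
  rw [e]
  calc _ ≤ _ := eLpNorm_sub_le ((hy.memLp_of_mem_span hζ).sub h.1).1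
        ((hy.memLp_of_mem_span hζ').sub h'.1).1 (by norm_num)
    _ < ε / 2 + ε / 2 := ENNReal.add_lt_add h1 h2
    _ = ε := ENNReal.add_halves ε

/-- The constants C‖ζ_n‖ of approximating combinations converge to C‖X‖ in L² norm, and Fatou's
lemma along an almost surely convergent subsequence transfers the exponential bound. Nonnegativity
of the constant is recorded because C has no assumed sign. -/
theorem IsStrictlySub.expBound (hφ : IsNFunction φ) (hy : IsStrictlySub φ P y C) {X : Ω → ℝ}
    (hX : MemMSClosure P y X) : 0 ≤ C * √(∫ ω, X ω ^ 2 ∂P) ∧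
      ExpBound φ P (C * √(∫ ω, X ω ^ 2 ∂P)) X := by
  choose ζ hζ hlt using fun n : ℕ => hX.2 ((n : ℝ≥0∞) + 1)⁻¹ (by simp)
  have hL := fun n => hy.memLp_of_mem_span (hζ n)
  have ht : Tendsto (fun n => eLpNorm (ζ n - X) 2 P) atTop (𝓝 0) := by
    refine tendsto_of_tendsto_of_tendsto_of_le_of_le tendsto_const_nhds ?_ (fun _ => zero_le)
      (fun n => (hlt n).le)
    have := ENNReal.tendsto_inv_nat_nhds_zero.comp (tendsto_add_atTop_nat 1)
    refine this.congr fun n => by simp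
  have hnorm : Tendsto (fun n => √(∫ ω, ζ n ω ^ 2 ∂P)) atTop (𝓝 √(∫ ω, X ω ^ 2 ∂P)) := by
    rw [sqrt_integral_sq hX.1]
    simp only [fun n => sqrt_integral_sq (hL n)]
    have h1 : Tendsto (fun n => (hL n).toLp) atTop (𝓝 hX.1.toLp) := by
      rw [Lp.tendsto_Lp_iff_tendsto_eLpNorm'']
      exact ht
    have h2 := h1.norm
    simpa [Lp.norm_toLp] using h2
  have hC := hnorm.const_mul C
  have hb := fun n => (expBound_tau hφ (hy.exists_expBound_of_mem_span hφ (hζ n))).mono hφ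
    (abs_le_abs_of_nonneg (tau_nonneg _) (hy.tau_le_of_mem_span (hζ n)))
  refine ⟨ge_of_tendsto' hC fun n => (tau_nonneg _).trans (hy.tau_le_of_mem_span (hζ n)), ?_⟩
  obtain ⟨ns, hns, hae⟩ := (tendstoInMeasure_of_tendsto_eLpNorm (by norm_num)
    (fun n => (hL n).1) hX.1.1 ht).exists_seq_tendsto_ae
  exact ExpBound.of_tendsto hφ (fun n => hb (ns n)) (hC.comp hns.tendsto_atTop) hae

end Strict

/-! ### Chaining -/

section Chaining

variable {Ω : Type*} [MeasurableSpace Ω] {P : Measure Ω} {φ : ℝ → ℝ} {T : Type*}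

/-- Jensen's inequality for the exponential with weights of total mass at most one. -/
theorem exp_sum_le {ι : Type*} (s : Finset ι) (w x : ι → ℝ) (hw : ∀ i ∈ s, 0 ≤ w i)
    (hw1 : ∑ i ∈ s, w i ≤ 1) :
    Real.exp (∑ i ∈ s, w i * x i) ≤ ∑ i ∈ s, w i * Real.exp (x i) + (1 - ∑ i ∈ s, w i) := by
  have := convexOn_exp.map_add_sum_le (t := s) (w := w) (p := x) (v := 1 - ∑ i ∈ s, w i) (q := 0)
    hw (by ring) (fun _ _ => mem_univ _) (sub_nonneg.mpr hw1) (mem_univ _)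
  simp only [smul_eq_mul, mul_zero, zero_add, Real.exp_zero, mul_one] at this
  linarith

/-- A bound for the exponential moment of a weighted sum of maxima. -/
theorem measure_sum_sup_gt_le [IsProbabilityMeasure P] (D : ℕ → T → Ω → ℝ) (S : ℕ → Finset T)
    (hS : ∀ n, (S n).Nonempty) (e α z B : ℕ → ℝ)
    (hD : ∀ n, ∀ u ∈ S n, ExpBound φ P (e n) (D n u)) (hα : ∀ n, 0 < α n) (m : ℕ)
    (hα1 : ∑ n ∈ Finset.range m, α n ≤ 1) {l : ℝ} (hl : 0 < l)
    (hez : ∀ n, e n * (l / α n) = z n) (hφ : IsNFunction φ)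
    (hB : ∀ n, 2 * (S n).card * Real.exp (φ (z n)) ≤ Real.exp (B n)) (v : ℝ) :
    P {ω | v < ∑ n ∈ Finset.range m, (((S n).sup fun u => ‖D n u ω‖₊ : NNReal) : ℝ)} ≤
      ENNReal.ofReal (Real.exp (∑ n ∈ Finset.range m, α n * B n - l * v)) := by
  set I := Finset.range m
  -- F n dominates α_n exp((l/α_n) M_n - B_n), M_n being the maximum of |D n u| over the net: the
  -- exponential of a maximum is at most the sum over the net and over both signs. The choice of B
  -- makes its integral at most α_n.
  set F : ℕ → Ω → ℝ≥0∞ := fun n ω => ENNReal.ofReal (α n * Real.exp (-B n)) *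
    ∑ u ∈ S n, (ENNReal.ofReal (Real.exp (l / α n * D n u ω)) +
      ENNReal.ofReal (Real.exp (-(l / α n) * D n u ω))) with hF
  have hFmeas : ∀ n ∈ I, AEMeasurable (F n) P := fun n _ =>
    (Finset.aemeasurable_fun_sum _ fun u hu =>
      ((hD n u hu).aemeas.ofReal_exp_mul _).add ((hD n u hu).aemeas.ofReal_exp_mul _)).const_mul _
  have hFint : ∀ n ∈ I, ∫⁻ ω, F n ω ∂P ≤ ENNReal.ofReal (α n) := fun n _ => by
    have hm : ∀ u ∈ S n, AEMeasurable (fun ω => ENNReal.ofReal (Real.exp (l / α n * D n u ω)) +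
        ENNReal.ofReal (Real.exp (-(l / α n) * D n u ω))) P := fun u hu =>
      ((hD n u hu).aemeas.ofReal_exp_mul _).add ((hD n u hu).aemeas.ofReal_exp_mul _)
    rw [hF, lintegral_const_mul' _ _ ENNReal.ofReal_ne_top, lintegral_finsetSum' _ hm]
    have h1 : ∀ u ∈ S n, ∫⁻ ω, (ENNReal.ofReal (Real.exp (l / α n * D n u ω)) +
        ENNReal.ofReal (Real.exp (-(l / α n) * D n u ω))) ∂P ≤
          ENNReal.ofReal (2 * Real.exp (φ (z n))) := fun u hu => by
      rw [lintegral_add_left' ((hD n u hu).aemeas.ofReal_exp_mul _), two_mul,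
        ENNReal.ofReal_add (by positivity) (by positivity)]
      refine add_le_add ?_ ?_
      · simpa only [hez] using (hD n u hu).le (l / α n)
      · simpa only [mul_neg, hez, hφ.even] using (hD n u hu).le (-(l / α n))
    refine (mul_le_mul_right (Finset.sum_le_card_nsmul _ _ _ h1) _).trans ?_
    rw [nsmul_eq_mul, ← ENNReal.ofReal_natCast, ← ENNReal.ofReal_mul (by positivity),
      ← ENNReal.ofReal_mul (mul_nonneg (hα n).le (Real.exp_pos _).le)]
    refine ENNReal.ofReal_le_ofReal ?_
    rw [mul_assoc]
    refine mul_le_of_le_one_right (hα n).le ?_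
    calc Real.exp (-B n) * ((S n).card * (2 * Real.exp (φ (z n))))
        = Real.exp (-B n) * (2 * (S n).card * Real.exp (φ (z n))) := by ring
      _ ≤ Real.exp (-B n) * Real.exp (B n) := by gcongr; exact hB n
      _ = 1 := by rw [← Real.exp_add, neg_add_cancel, Real.exp_zero]
  set M : ℕ → Ω → ℝ := fun n ω => ((S n).sup fun u => ‖D n u ω‖₊ : NNReal) with hM
  have hMF : ∀ n ∈ I, ∀ ω, ENNReal.ofReal (α n * Real.exp (l / α n * M n ω - B n)) ≤ F n ω := by
    intro n _ ω
    obtain ⟨u, hu, hsup⟩ := Finset.exists_mem_eq_sup (S n) (hS n) fun u => ‖D n u ω‖₊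
    have hMu : M n ω = |D n u ω| := by simp [hM, hsup]
    have h1 : Real.exp (l / α n * M n ω) ≤
        Real.exp (l / α n * D n u ω) + Real.exp (-(l / α n) * D n u ω) := by
      rw [hMu]
      rcases abs_choice (D n u ω) with h | h <;> rw [h]
      · exact le_add_of_nonneg_right (by positivity)
      · rw [mul_neg, neg_mul]
        exact le_add_of_nonneg_left (by positivity)
    rw [sub_eq_add_neg, Real.exp_add, mul_comm (Real.exp _), ← mul_assoc,
      ENNReal.ofReal_mul (mul_nonneg (hα n).le (Real.exp_pos _).le), hF]
    refine mul_le_mul_right ?_ _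
    refine le_trans ?_ (Finset.single_le_sum (f := fun u =>
      ENNReal.ofReal (Real.exp (l / α n * D n u ω)) +
      ENNReal.ofReal (Real.exp (-(l / α n) * D n u ω))) (fun _ _ => zero_le) hu)
    rw [← ENNReal.ofReal_add (by positivity) (by positivity)]
    exact ENNReal.ofReal_le_ofReal h1
  set G : Ω → ℝ≥0∞ := fun ω => ∑ n ∈ I, F n ω + ENNReal.ofReal (1 - ∑ n ∈ I, α n) with hG
  have hGmeas : AEMeasurable G P := (Finset.aemeasurable_fun_sum _ hFmeas).add_const _
  have hGint : ∫⁻ ω, G ω ∂P ≤ 1 := by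
    rw [hG, lintegral_add_right' _ aemeasurable_const, lintegral_finsetSum' _ hFmeas,
      lintegral_const, measure_univ, mul_one]
    refine (add_le_add_left (Finset.sum_le_sum hFint) _).trans ?_
    rw [← ENNReal.ofReal_sum_of_nonneg fun n _ => (hα n).le,
      ← ENNReal.ofReal_add (Finset.sum_nonneg fun n _ => (hα n).le) (sub_nonneg.mpr hα1)]
    simp
  -- Jensen's inequality, the missing mass 1 - ∑ α_n being put at 0. Together with E G ≤ 1 this
  -- leaves only Markov's inequality.
  have hexp : ∀ ω, ENNReal.ofReal (Real.exp (l * ∑ n ∈ I, M n ω - ∑ n ∈ I, α n * B n)) ≤ G ω := by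
    intro ω
    have h1 := exp_sum_le I α (fun n => l / α n * M n ω - B n) (fun n _ => (hα n).le) hα1
    have h2 : ∑ n ∈ I, α n * (l / α n * M n ω - B n) =
        l * ∑ n ∈ I, M n ω - ∑ n ∈ I, α n * B n := by
      rw [Finset.mul_sum, ← Finset.sum_sub_distrib]
      refine Finset.sum_congr rfl fun n _ => ?_
      have := (hα n).ne'
      field_simp
    rw [h2] at h1
    refine (ENNReal.ofReal_le_ofReal h1).trans ?_
    rw [ENNReal.ofReal_add (Finset.sum_nonneg fun n _ => mul_nonneg (hα n).le (Real.exp_pos _).le)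
      (sub_nonneg.mpr hα1), ENNReal.ofReal_sum_of_nonneg fun n _ =>
        mul_nonneg (hα n).le (Real.exp_pos _).le]
    exact add_le_add_left (Finset.sum_le_sum fun n hn => hMF n hn ω) _
  set c := Real.exp (l * v - ∑ n ∈ I, α n * B n) with hc
  have hsub : {ω | v < ∑ n ∈ I, M n ω} ⊆ {ω | ENNReal.ofReal c ≤ G ω} := fun ω hω => by
    refine le_trans (ENNReal.ofReal_le_ofReal (Real.exp_le_exp.mpr ?_)) (hexp ω)
    have := mul_le_mul_of_nonneg_left (le_of_lt hω) hl.le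
    linarith
  have hmk := (mul_meas_ge_le_lintegral₀ hGmeas (ENNReal.ofReal c)).trans hGint
  have hfin : P {ω | ENNReal.ofReal c ≤ G ω} ≤ ENNReal.ofReal c⁻¹ := by
    rw [ENNReal.ofReal_inv_of_pos (Real.exp_pos _)]
    exact (ENNReal.le_inv_iff_mul_le).mpr (by rwa [mul_comm])
  refine (measure_mono hsub).trans (hfin.trans_eq ?_)
  rw [hc, ← Real.exp_neg, neg_sub]

/-- Chaining: along nets `S n` in which `X` moves by at most `ε θ ^ n`. -/
theorem measure_exists_gt_le [IsProbabilityMeasure P] (hφ : IsNFunction φ) (X : T → Ω → ℝ)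
    (S : ℕ → Finset T) (hS : ∀ n, (S n).Nonempty) (H : ℕ → ℝ) (hH : ∀ n, 0 ≤ H n)
    (hSH : ∀ n, ((S n).card : ℝ) ≤ Real.exp (H n)) {ε θ J : ℝ} (hε : 0 < ε) (hθ0 : 0 < θ)
    (hθ1 : θ < 1) (h0 : ∀ u ∈ S 0, ExpBound φ P ε (X u))
    (hstep : ∀ n, ∀ u ∈ S (n + 1), ∃ v ∈ S n, ExpBound φ P (ε * θ ^ (n + 1)) (X u - X v))
    (hJ : ∀ m, ∑ n ∈ Finset.range m, ε * θ ^ n * Psi φ (H n) ≤ J) {l : ℝ} (hl : 0 < l) (v : ℝ) :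
    P {ω | ∃ n, ∃ u ∈ S n, v < |X u ω|} ≤
      ENNReal.ofReal (2 * Real.exp (φ (l * ε / (1 - θ)) + 2 * l * J - l * v)) := by
  classical
  choose! π hπS hπ using hstep
  set D : ℕ → T → Ω → ℝ := fun n => Nat.casesOn n X fun n u => X u - X (π n u) with hDdef
  have hD : ∀ n, ∀ u ∈ S n, ExpBound φ P (ε * θ ^ n) (D n u) := by
    rintro (_ | n) u hu
    · rw [pow_zero, mul_one]
      exact h0 u hu
    · exact hπ n u hu
  have h1θ : 0 < 1 - θ := sub_pos.mpr hθ1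
  set r := l * ε / (1 - θ) with hr
  have hr0 : 0 < r := by positivity
  -- The maximum serves two purposes: z_n ≥ r gives α_n ≤ (1-θ)θ^n, so the weights have mass at most
  -- 1, and z_n ≥ φ⁻¹(H_n) gives α_n H_n ≤ l ε θ^n Ψ(H_n). Still φ(z_n) ≤ H_n + φ(r).
  set z : ℕ → ℝ := fun n => max r (incInv φ (H n)) with hz
  have hz0 : ∀ n, 0 < z n := fun n => hr0.trans_le (le_max_left _ _)
  have hφz : ∀ n, φ (z n) ≤ H n + φ r := fun n => by
    rcases max_choice r (incInv φ (H n)) with h | h <;> simp only [hz, h]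
    · linarith [hH n]
    · rw [hφ.apply_incInv (hH n)]; linarith [hφ.nonneg r]
  set α : ℕ → ℝ := fun n => l * (ε * θ ^ n) / z n with hα
  have hα0 : ∀ n, 0 < α n := fun n => div_pos (by positivity) (hz0 n)
  have hαle : ∀ n, α n ≤ (1 - θ) * θ ^ n := fun n => by
    calc α n ≤ l * (ε * θ ^ n) / r := by
          simp only [hα]; gcongr; exact le_max_left _ _
      _ = (1 - θ) * θ ^ n := by rw [hr]; field_simp
  have hαsum : ∀ m, ∑ n ∈ Finset.range m, α n ≤ 1 := fun m => by
    refine (Finset.sum_le_sum fun n _ => hαle n).trans ?_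
    rw [← Finset.mul_sum, mul_neg_geom_sum]
    linarith [pow_pos hθ0 m]
  have hαH : ∀ n, α n * H n ≤ l * (ε * θ ^ n * Psi φ (H n)) := fun n => by
    rcases (hH n).eq_or_lt with h | h
    · simp [← h, hφ.psi_of_nonpos le_rfl]
    · have hi := hφ.incInv_pos h
      calc α n * H n ≤ l * (ε * θ ^ n) / incInv φ (H n) * H n := by
            simp only [hα]; gcongr; exact le_max_right _ _
        _ = _ := by rw [Psi]; ring
  -- One H_n pays for the cardinality of the net, the other for φ(z_n). This is the origin of the
  -- term 2lJ.
  set B : ℕ → ℝ := fun n => Real.log 2 + (2 * H n + φ r) with hB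
  have hBle : ∀ n, 2 * (S n).card * Real.exp (φ (z n)) ≤ Real.exp (B n) := fun n => by
    rw [hB, Real.exp_add, Real.exp_log two_pos, mul_assoc]
    gcongr
    calc (S n).card * Real.exp (φ (z n)) ≤ Real.exp (H n) * Real.exp (H n + φ r) := by
          gcongr
          · exact hSH n
          · exact hφz n
      _ = _ := by rw [← Real.exp_add]; ring_nf
  have hαB : ∀ m, ∑ n ∈ Finset.range m, α n * B n ≤ Real.log 2 + φ r + 2 * l * J := fun m => by
    have hc : 0 ≤ Real.log 2 + φ r := add_nonneg (Real.log_nonneg one_le_two) (hφ.nonneg r)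
    calc ∑ n ∈ Finset.range m, α n * B n
        = (∑ n ∈ Finset.range m, α n) * (Real.log 2 + φ r) +
            2 * ∑ n ∈ Finset.range m, α n * H n := by
          rw [Finset.sum_mul, Finset.mul_sum, ← Finset.sum_add_distrib]
          exact Finset.sum_congr rfl fun n _ => by simp only [hB]; ring
      _ ≤ 1 * (Real.log 2 + φ r) +
            2 * ∑ n ∈ Finset.range m, l * (ε * θ ^ n * Psi φ (H n)) := by
          exact add_le_add (mul_le_mul_of_nonneg_right (hαsum m) hc)
            (mul_le_mul_of_nonneg_left (Finset.sum_le_sum fun n _ => hαH n) two_pos.le)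
      _ ≤ Real.log 2 + φ r + 2 * l * J := by
          rw [← Finset.mul_sum]
          have := mul_le_mul_of_nonneg_left (hJ m) hl.le
          linarith
  set W : ℕ → Ω → ℝ := fun m ω =>
    ∑ n ∈ Finset.range m, ((S n).sup fun u => ‖D n u ω‖₊ : NNReal) with hW
  have hWmono : ∀ ω, Monotone fun m => W m ω := fun ω => monotone_nat_of_le_succ fun m => by
    simp only [hW, Finset.sum_range_succ]
    exact le_add_of_nonneg_right (NNReal.coe_nonneg _)
  have hDsup : ∀ n, ∀ u ∈ S n, ∀ ω,
      |D n u ω| ≤ ((S n).sup fun u => ‖D n u ω‖₊ : NNReal) := fun n u hu ω => by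
    have := Finset.le_sup (f := fun u => ‖D n u ω‖₊) hu
    rw [← NNReal.coe_le_coe] at this
    simpa using this
  have hXW : ∀ n, ∀ u ∈ S n, ∀ ω, |X u ω| ≤ W (n + 1) ω := by
    intro n
    induction n with
    | zero =>
      intro u hu ω
      simp only [hW, zero_add, Finset.sum_range_one]
      exact hDsup 0 u hu ω
    | succ n ih =>
      intro u hu ω
      simp only [hW]
      rw [Finset.sum_range_succ]
      have h1 := ih _ (hπS n u hu) ω
      have h2 : |X u ω - X (π n u) ω| ≤ _ := hDsup (n + 1) u hu ω
      have h3 := abs_sub_abs_le_abs_sub (X u ω) (X (π n u) ω)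
      simp only [hW] at h1
      linarith
  have hsub : {ω | ∃ n, ∃ u ∈ S n, v < |X u ω|} ⊆ ⋃ m, {ω | v < W m ω} := by
    rintro ω ⟨n, u, hu, hv⟩
    exact mem_iUnion.mpr ⟨n + 1, hv.trans_le (hXW n u hu ω)⟩
  refine (measure_mono hsub).trans ?_
  have hmono : Monotone fun m => {ω | v < W m ω} :=
    fun m m' hm ω (hω : v < W m ω) => hω.trans_le (hWmono ω hm)
  rw [hmono.measure_iUnion]
  refine iSup_le fun m => ?_
  refine (measure_sum_sup_gt_le D S hS _ α z B hD hα0 m (hαsum m) hl (fun n => ?_) hφ hBle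
    v).trans ?_
  · have := (hz0 n).ne'
    simp only [hα]
    field_simp
  · refine ENNReal.ofReal_le_ofReal ?_
    calc _ ≤ Real.exp (Real.log 2 + (φ r + 2 * l * J - l * v)) := by
          gcongr
          linarith [hαB m]
      _ = _ := by rw [Real.exp_add, Real.exp_log two_pos]

/-- Optimization of the Chernoff parameter in the chaining bound. -/
theorem measure_le_exp_neg_youngConj [IsProbabilityMeasure P] (hφ : IsNFunction φ) {E : Set Ω}
    {ε θ J u : ℝ} (hε : 0 < ε) (hθ1 : θ < 1) (hu0 : 0 ≤ u) (hu : 4 * J ≤ u)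
    (hE : ∀ l > 0, ∀ v < u,
      P E ≤ ENNReal.ofReal (2 * Real.exp (φ (l * ε / (1 - θ)) + 2 * l * J - l * v))) :
    P E ≤ ENNReal.ofReal (2 * Real.exp (-youngConj φ (u * (1 - θ) / (2 * ε)))) := by
  have h1θ : 0 < 1 - θ := sub_pos.mpr hθ1
  set a := u * (1 - θ) / (2 * ε) with ha
  have ha0 : 0 ≤ a := by positivity
  -- A bound for every x, as φ* is a supremum over all reals; for x ≤ 0 the right side is at least
  -- 2. For x > 0, l is chosen with lε/(1-θ) = x, and then lu = 2ax: one half gives ax, the other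
  -- absorbs 2lJ.
  have key : ∀ x : ℝ, (P E).toReal ≤ 2 * Real.exp (-(a * x - φ x)) := fun x => by
    rcases le_or_gt x 0 with hx | hx
    · calc (P E).toReal ≤ 1 := measureReal_le_one
        _ ≤ 2 * 1 := by norm_num
        _ ≤ _ := by
          gcongr
          rw [Real.one_le_exp_iff]
          have := mul_nonneg ha0 (neg_nonneg.mpr hx)
          linarith [hφ.nonneg x]
    · set l := x * (1 - θ) / ε with hl
      have hl0 : 0 < l := by positivity
      have hlx : l * ε / (1 - θ) = x := by rw [hl]; field_simp
      have hlu : l * u = 2 * (a * x) := by rw [hl, ha]; field_simp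
      have h1 : (P E).toReal ≤ 2 * Real.exp (φ x + 2 * l * J - l * u) := by
        have hc : Continuous fun v => 2 * Real.exp (φ x + 2 * l * J - l * v) := by fun_prop
        refine ge_of_tendsto (hc.continuousWithinAt (s := Iio u) (x := u)) ?_
        filter_upwards [self_mem_nhdsWithin] with v hv
        have := hE l hl0 v hv
        rw [hlx] at this
        exact ENNReal.toReal_le_of_le_ofReal (by positivity) this
      refine h1.trans ?_
      gcongr
      have := mul_le_mul_of_nonneg_left hu hl0.le
      linarith
  rw [← ENNReal.ofReal_toReal (measure_ne_top P E)]
  refine ENNReal.ofReal_le_ofReal ?_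
  -- Optimization over x passes through the logarithm, hence the separate case of probability 0.
  rcases (ENNReal.toReal_nonneg (a := P E)).eq_or_lt with h | h
  · rw [← h]; positivity
  · rw [← div_le_iff₀' two_pos, ← Real.log_le_iff_le_exp (by positivity), le_neg]
    refine ciSup_le fun x => ?_
    rw [le_neg, Real.log_le_iff_le_exp (by positivity), div_le_iff₀' two_pos]
    exact key x

end Chaining

/-! ### The kernel -/

section Kernel

variable {φ Z : ℝ → ℝ} {u₀ : ℝ}

namespace IsAdmissible

theorem monotoneOn (hZ : IsAdmissible φ Z u₀) : MonotoneOn Z (Ici 0) := hZ.strictMono.monotoneOn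

theorem nonneg (hZ : IsAdmissible φ Z u₀) {u : ℝ} (hu : 0 ≤ u) : 0 ≤ Z u := by
  rcases hu.eq_or_lt with rfl | hu
  · have h1 : Tendsto Z (𝓝[>] 0) (𝓝 (Z 0)) :=
      (hZ.cont 0 (mem_Ici.mpr le_rfl)).mono_left (nhdsWithin_mono _ Ioi_subset_Ici_self)
    refine ge_of_tendsto h1 ?_
    filter_upwards [self_mem_nhdsWithin] with x hx
    exact (hZ.pos x hx).le
  · exact (hZ.pos u hu).le

/-- If w ≤ |l|/2, use |sin| ≤ 1 and monotonicity of Z. Otherwise |sin|(w + u₀) ≤ |l|/2 + u₀, and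
monotonicity of u/Z(u) converts this ratio into one of values of Z. -/
theorem abs_sin_le (hZ : IsAdmissible φ Z u₀) {w : ℝ} (hw : 0 ≤ w) (hZw : 0 < Z (w + u₀))
    {l d : ℝ} (hd : w * |d| ≤ 1) : |Real.sin (l * d / 2)| ≤ Z (|l| / 2 + u₀) / Z (w + u₀) := by
  have h0 := hZ.u₀_nonneg
  have hl : 0 ≤ |l| / 2 := by positivity
  rw [le_div_iff₀ hZw]
  rcases le_or_gt w (|l| / 2) with h | h
  · calc _ ≤ 1 * Z (w + u₀) := by gcongr; exact Real.abs_sin_le_one _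
      _ ≤ _ := by
        rw [one_mul]
        exact hZ.monotoneOn (by simp; linarith) (by simp; linarith) (by linarith)
  rcases eq_or_ne l 0 with rfl | hl0
  · simpa using hZ.nonneg h0
  have hl' : 0 < |l| / 2 := by positivity
  have hZl : 0 < Z (|l| / 2 + u₀) := hZ.pos _ (by linarith)
  have hm := hZ.mono_div (show |l| / 2 + u₀ ∈ Ioi u₀ by simpa using hl0)
    (show w + u₀ ∈ Ioi u₀ by simp; linarith) (by linarith)
  simp only at hm
  rw [div_le_div_iff₀ hZl hZw] at hm
  have hwu : 0 < w + u₀ := by linarith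
  have h1 : |Real.sin (l * d / 2)| * (w + u₀) ≤ |l| / 2 + u₀ := by
    have hs1 := Real.abs_sin_le_one (l * d / 2)
    have hs2 : |Real.sin (l * d / 2)| ≤ |l| / 2 * |d| := by
      refine Real.abs_sin_le_abs.trans_eq ?_
      rw [abs_div, abs_mul, abs_two]
      ring
    have h3 : |Real.sin (l * d / 2)| * w ≤ |l| / 2 := by
      calc _ ≤ |l| / 2 * |d| * w := by gcongr
        _ = |l| / 2 * (w * |d|) := by ring
        _ ≤ |l| / 2 * 1 := by gcongr
        _ = _ := mul_one _
    have h4 : |Real.sin (l * d / 2)| * u₀ ≤ u₀ := mul_le_of_le_one_left h0 hs1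
    linarith
  have h5 : |Real.sin (l * d / 2)| * Z (w + u₀) * (w + u₀) ≤ Z (|l| / 2 + u₀) * (w + u₀) := by
    calc _ = |Real.sin (l * d / 2)| * (w + u₀) * Z (w + u₀) := by ring
      _ ≤ (|l| / 2 + u₀) * Z (w + u₀) := by gcongr
      _ ≤ _ := by linarith
  exact le_of_mul_le_mul_right h5 hwu

theorem continuous_weight (hZ : IsAdmissible φ Z u₀) (N : ℕ) (a : ℕ → ℝ) :
    Continuous (weight Z u₀ N a) := by
  have h0 := hZ.u₀_nonneg
  have hs : Continuous (symb N a) := by unfold symb; fun_prop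
  have h1 : Continuous fun l : ℝ => Z (|l| / 2 + u₀) :=
    hZ.cont.comp_continuous (by fun_prop) fun l => add_nonneg (by positivity) h0
  have h2 : Continuous fun l : ℝ => Z (1 / 2 * |symb N a l| + u₀) :=
    hZ.cont.comp_continuous (by fun_prop) fun l => add_nonneg (by positivity) h0
  exact h1.add h2

theorem abs_kernelI_sub_le (hZ : IsAdmissible φ Z u₀) {κ : ℝ → ℝ}
    (hκ : κ = Real.cos ∨ κ = Real.sin) (N : ℕ) (a : ℕ → ℝ) {w : ℝ} (hw : 0 ≤ w)
    (hZw : 0 < Z (w + u₀)) {t x t' x' : ℝ} (hx : w * |x - x'| ≤ 1) (ht : w * |t - t'| ≤ 1) (l : ℝ) :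
    |kernelI κ N a t x l - kernelI κ N a t' x' l| ≤
      2 / Z (w + u₀) * weight Z u₀ N a l := by
  have h1 : ∀ α β : ℝ, |κ α - κ β| ≤ 2 * |Real.sin ((α - β) / 2)| := fun α β => by
    rcases hκ with rfl | rfl
    · rw [Real.cos_sub_cos, abs_mul, abs_mul, abs_neg, abs_two]
      gcongr
      exact mul_le_of_le_one_right two_pos.le (Real.abs_sin_le_one _)
    · rw [Real.sin_sub_sin, abs_mul, abs_mul, abs_two]
      exact mul_le_of_le_one_right (by positivity) (Real.abs_cos_le_one _)
  have h2 : ∀ α β : ℝ, |Real.sin (α + β)| ≤ |Real.sin α| + |Real.sin β| := fun α β => by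
    rw [Real.sin_add]
    refine (abs_add_le _ _).trans ?_
    rw [abs_mul, abs_mul]
    exact add_le_add (mul_le_of_le_one_right (abs_nonneg _) (Real.abs_cos_le_one _))
      (mul_le_of_le_one_left (abs_nonneg _) (Real.abs_cos_le_one _))
  have h3 := hZ.abs_sin_le hw hZw (l := l) hx
  have h4 := hZ.abs_sin_le hw hZw (l := symb N a l) ht
  have h5 := h2 (l * (x - x') / 2) (symb N a l * (t - t') / 2)
  have e : (l * x + t * symb N a l - (l * x' + t' * symb N a l)) / 2 =
      l * (x - x') / 2 + symb N a l * (t - t') / 2 := by ring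
  refine (h1 _ _).trans ?_
  rw [e, weight, show 1 / 2 * |symb N a l| = |symb N a l| / 2 by ring, div_mul_eq_mul_div,
    mul_div_assoc 2, add_div (Z _)]
  linarith

end IsAdmissible

end Kernel

/-! ### Mean-square Stieltjes integrals -/

section Stieltjes

variable {Ω : Type*}

/-- The Riemann-Stieltjes sum `∑ f(r i) (y(p (i + 1)) - y(p i))`. -/
def stieltjesSum (y : ℝ → Ω → ℝ) (f : ℝ → ℝ) (p r : ℕ → ℝ) (n : ℕ) : Ω → ℝ :=
  ∑ i ∈ Finset.range n, f (r i) • (y (p (i + 1)) - y (p i))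

theorem stieltjesSum_apply (y : ℝ → Ω → ℝ) (f : ℝ → ℝ) (p r : ℕ → ℝ) (n : ℕ) (ω : Ω) :
    stieltjesSum y f p r n ω = ∑ i ∈ Finset.range n, f (r i) * (y (p (i + 1)) ω - y (p i) ω) := by
  simp [stieltjesSum, Finset.sum_apply]

theorem stieltjesSum_mem_span (y : ℝ → Ω → ℝ) (f : ℝ → ℝ) (p r : ℕ → ℝ) (n : ℕ) :
    stieltjesSum y f p r n ∈ Submodule.span ℝ (range y) :=
  Submodule.sum_mem _ fun _ _ => Submodule.smul_mem _ _ <|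
    sub_mem (Submodule.subset_span (mem_range_self _)) (Submodule.subset_span (mem_range_self _))

variable [MeasurableSpace Ω] {P : Measure Ω}

theorem memLp_stieltjesSum {y : ℝ → Ω → ℝ} (hy : ∀ u, MemLp (y u) 2 P) (f : ℝ → ℝ)
    (p r : ℕ → ℝ) (n : ℕ) : MemLp (stieltjesSum y f p r n) 2 P :=
  memLp_finsetSum' _ fun _ _ => ((hy _).sub (hy _)).const_smul _

/-- The sequence is monotone on all of ℕ, stopping at b, because the grids of `varIntegral` are
required to be globally monotone. -/
theorem exists_partition {a b δ : ℝ} (hab : a ≤ b) (hδ : 0 < δ) :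
    ∃ (n : ℕ) (p : ℕ → ℝ), Monotone p ∧ p 0 = a ∧ p n = b ∧ (∀ i, p i ∈ Icc a b) ∧
      ∀ i, p (i + 1) - p i < δ := by
  obtain ⟨n, hn⟩ := exists_nat_gt ((b - a) / (δ / 2))
  refine ⟨n, fun i => min (a + i * (δ / 2)) b, fun i j hij => ?_, by simpa using hab, ?_,
    fun i => ⟨le_min (by linarith [show 0 ≤ i * (δ / 2) by positivity]) hab, min_le_right _ _⟩,
    fun i => ?_⟩
  · simp only
    gcongr
  · rw [div_lt_iff₀ (half_pos hδ)] at hn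
    exact min_eq_right (by linarith)
  · push_cast
    rcases min_choice (a + i * (δ / 2)) b with h | h <;> rw [h]
    · linarith [min_le_left (a + (i + 1) * (δ / 2)) b]
    · linarith [min_le_right (a + (i + 1) * (δ / 2)) b]

/-- A common interval and mesh for both integrals allows their sums to be subtracted term by term on
the same partition. -/
theorem HasMSIntegral.exists_delta {y : ℝ → Ω → ℝ} (hy : ∀ u, MemLp (y u) 2 P)
    {f f' : ℝ → ℝ} {X X' : Ω → ℝ}
    (h : HasMSIntegral P y f X) (h' : HasMSIntegral P y f' X') {ε : ℝ≥0∞} (hε : 0 < ε) :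
    ∃ a b δ : ℝ, a ≤ b ∧ 0 < δ ∧ ∀ (n : ℕ) (p r : ℕ → ℝ), p 0 = a → p n = b →
      (∀ i < n, p i ≤ p (i + 1) ∧ p (i + 1) - p i < δ ∧ r i ∈ Icc (p i) (p (i + 1))) →
      eLpNorm (stieltjesSum y f p r n - X) 2 P < ε ∧
        eLpNorm (stieltjesSum y f' p r n - X') 2 P < ε := by
  obtain ⟨hX, J, hJ, hlim⟩ := h
  obtain ⟨hX', J', hJ', hlim'⟩ := h'
  have hε2 : 0 < ε / 2 := ENNReal.half_pos hε.ne'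
  have hev : ∀ᶠ q : ℝ × ℝ in atBot ×ˢ atTop, q.1 ≤ 0 ∧ 0 ≤ q.2 :=
    (tendsto_fst.eventually (eventually_le_atBot 0)).and
      (tendsto_snd.eventually (eventually_ge_atTop 0))
  obtain ⟨⟨a, b⟩, ⟨ha, hb⟩, h1, h1'⟩ := (hev.and ((hlim.eventually_lt_const hε2).and
    (hlim'.eventually_lt_const hε2))).exists
  have hab : a ≤ b := le_trans ha hb
  obtain ⟨hL, hs⟩ := hJ a b hab
  obtain ⟨hL', hs'⟩ := hJ' a b hab
  obtain ⟨δ, hδ, hs⟩ := hs _ hε2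
  obtain ⟨δ', hδ', hs'⟩ := hs' _ hε2
  have tri : ∀ (f : ℝ → ℝ) (n : ℕ) (p r : ℕ → ℝ) (I Y : Ω → ℝ), MemLp I 2 P → MemLp Y 2 P →
      eLpNorm (fun ω => (∑ i ∈ Finset.range n, f (r i) * (y (p (i + 1)) ω - y (p i) ω)) - I ω)
          2 P < ε / 2 → eLpNorm (fun ω => I ω - Y ω) 2 P < ε / 2 →
      eLpNorm (stieltjesSum y f p r n - Y) 2 P < ε := by
    intro f n p r I Y hI hY hl1 hl2
    have e : stieltjesSum y f p r n - Y = (stieltjesSum y f p r n - I) + (I - Y) := by abel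
    have e1 : (fun ω => (∑ i ∈ Finset.range n, f (r i) * (y (p (i + 1)) ω - y (p i) ω)) - I ω) =
        stieltjesSum y f p r n - I := by
      ext ω
      rw [Pi.sub_apply, stieltjesSum_apply]
    rw [e1] at hl1
    rw [e]
    calc _ ≤ _ := eLpNorm_add_le ((memLp_stieltjesSum hy f p r n).sub hI).1 (hI.sub hY).1
          (by norm_num)
      _ < ε / 2 + ε / 2 := ENNReal.add_lt_add hl1 hl2
      _ = ε := ENNReal.add_halves ε
  refine ⟨a, b, min δ δ', hab, lt_min hδ hδ', fun n p r hp0 hpn hp => ⟨?_, ?_⟩⟩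
  · exact tri f n p r _ _ hL hX (hs n p r hp0 hpn fun i hi =>
      ⟨(hp i hi).1, (hp i hi).2.1.trans_le (min_le_left _ _), (hp i hi).2.2⟩) h1
  · exact tri f' n p r _ _ hL' hX' (hs' n p r hp0 hpn fun i hi =>
      ⟨(hp i hi).1, (hp i hi).2.1.trans_le (min_le_right _ _), (hp i hi).2.2⟩) h1'

theorem HasMSIntegral.memMSClosure {y : ℝ → Ω → ℝ} (hy : ∀ u, MemLp (y u) 2 P) {f : ℝ → ℝ}
    {X : Ω → ℝ} (h : HasMSIntegral P y f X) : MemMSClosure P y X := by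
  refine ⟨h.1, fun ε hε => ?_⟩
  obtain ⟨a, b, δ, hab, hδ, hs⟩ := h.exists_delta hy h hε
  obtain ⟨n, p, hpm, hp0, hpn, -, hpδ⟩ := exists_partition hab hδ
  exact ⟨_, stieltjesSum_mem_span y f p p n, (hs n p p hp0 hpn fun i _ =>
    ⟨hpm i.le_succ, hpδ i, le_rfl, hpm i.le_succ⟩).1⟩

theorem integral_stieltjesSum_sq {y : ℝ → Ω → ℝ} (hy : ∀ u, MemLp (y u) 2 P) (f : ℝ → ℝ)
    (p r : ℕ → ℝ) (n : ℕ) :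
    ∫ ω, stieltjesSum y f p r n ω ^ 2 ∂P = ∑ i ∈ Finset.range n, ∑ j ∈ Finset.range n,
      f (r i) * f (r j) * rectIncr (covFun P y) (p i) (p (i + 1)) (p j) (p (j + 1)) := by
  have hi : ∀ u v, Integrable (fun ω => y u ω * y v ω) P := fun u v => (hy u).integrable_mul (hy v)
  have e : ∀ ω, stieltjesSum y f p r n ω ^ 2 = ∑ i ∈ Finset.range n, ∑ j ∈ Finset.range n,
      f (r i) * f (r j) * (y (p (i + 1)) ω * y (p (j + 1)) ω - y (p i) ω * y (p (j + 1)) ω -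
        y (p (i + 1)) ω * y (p j) ω + y (p i) ω * y (p j) ω) := fun ω => by
    rw [stieltjesSum_apply, sq, Finset.sum_mul_sum]
    exact Finset.sum_congr rfl fun i _ => Finset.sum_congr rfl fun j _ => by ring
  simp only [e]
  have hij : ∀ i j, Integrable (fun ω => f (r i) * f (r j) *
      (y (p (i + 1)) ω * y (p (j + 1)) ω - y (p i) ω * y (p (j + 1)) ω -
        y (p (i + 1)) ω * y (p j) ω + y (p i) ω * y (p j) ω)) P := fun i j =>
    ((((hi _ _).sub (hi _ _)).sub (hi _ _)).add (hi _ _)).const_mul _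
  rw [integral_finsetSum _ fun i _ => integrable_finsetSum _ fun j _ => hij i j]
  refine Finset.sum_congr rfl fun i _ => ?_
  rw [integral_finsetSum _ fun j _ => hij i j]
  refine Finset.sum_congr rfl fun j _ => ?_
  have h1 : Integrable (fun ω => y (p (i + 1)) ω * y (p (j + 1)) ω - y (p i) ω * y (p (j + 1)) ω)
      P := (hi _ _).sub (hi _ _)
  have h2 : Integrable (fun ω => y (p (i + 1)) ω * y (p (j + 1)) ω - y (p i) ω * y (p (j + 1)) ω -
      y (p (i + 1)) ω * y (p j) ω) P := h1.sub (hi _ _)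
  rw [integral_const_mul, integral_add h2 (hi _ _), integral_sub h1 (hi _ _),
    integral_sub (hi _ _) (hi _ _)]
  rfl

/-- Corner values exceed the infimum over the cell by at most η, which costs η times the total
variation. -/
theorem ofReal_sum_le_varIntegral (G : ℝ → ℝ → ℝ) (g : ℝ → ℝ → ℝ) {p q : ℕ → ℝ} (hp : Monotone p)
    (hq : Monotone q) (n m : ℕ) {η : ℝ}
    (hg : ∀ i j, ∀ u ∈ Icc (p i) (p (i + 1)), ∀ v ∈ Icc (q j) (q (j + 1)),
      g (p i) (q j) ≤ g u v + η) :
    ENNReal.ofReal (∑ i ∈ Finset.range n, ∑ j ∈ Finset.range m,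
      g (p i) (q j) * |rectIncr G (p i) (p (i + 1)) (q j) (q (j + 1))|) ≤
      varIntegral G g + ENNReal.ofReal η * varIntegral G fun _ _ => 1 := by
  have hle : ∀ g : ℝ → ℝ → ℝ, ∑ i ∈ Finset.range n, ∑ j ∈ Finset.range m,
      (⨅ (u ∈ Icc (p i) (p (i + 1))) (v ∈ Icc (q j) (q (j + 1))), ENNReal.ofReal (g u v)) *
        ENNReal.ofReal |rectIncr G (p i) (p (i + 1)) (q j) (q (j + 1))| ≤ varIntegral G g :=
    fun g => le_iSup_of_le n <| le_iSup_of_le m <| le_iSup_of_le p <| le_iSup_of_le q <|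
      le_iSup_of_le hp <| le_iSup_of_le hq le_rfl
  refine le_trans ?_ (add_le_add (hle g) (mul_le_mul_right (hle fun _ _ => 1) _))
  rw [Finset.mul_sum, ← Finset.sum_add_distrib]
  refine (Finset.le_sum_of_subadditive _ (by simp) (fun x y => ENNReal.ofReal_add_le) _ _).trans ?_
  refine Finset.sum_le_sum fun i _ => ?_
  rw [Finset.mul_sum, ← Finset.sum_add_distrib]
  refine (Finset.le_sum_of_subadditive _ (by simp) (fun x y => ENNReal.ofReal_add_le) _ _).trans ?_
  refine Finset.sum_le_sum fun j _ => ?_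
  rw [ENNReal.ofReal_mul' (abs_nonneg _), ← mul_assoc, ← add_mul]
  refine mul_le_mul_left ?_ _
  have h1 : (1 : ℝ≥0∞) ≤ ⨅ (u ∈ Icc (p i) (p (i + 1))) (v ∈ Icc (q j) (q (j + 1))),
      ENNReal.ofReal 1 := le_iInf₂ fun u _ => le_iInf₂ fun v _ => by simp
  calc ENNReal.ofReal (g (p i) (q j)) ≤
      (⨅ (u ∈ Icc (p i) (p (i + 1))) (v ∈ Icc (q j) (q (j + 1))), ENNReal.ofReal (g u v)) +
        ENNReal.ofReal η * 1 := by
        rw [mul_one, ← tsub_le_iff_right]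
        refine le_iInf₂ fun u hu => le_iInf₂ fun v hv => ?_
        rw [tsub_le_iff_right]
        exact (ENNReal.ofReal_le_ofReal (hg i j u hu v hv)).trans ENNReal.ofReal_add_le
    _ ≤ _ := by gcongr

/-- The isometry inequality: if `|f - f'| ≤ C g`, the mean-square distance between `∫ f dy` and
`∫ f' dy` is at most `C (∫∫ g(u) g(v) |dΓ(u, v)|)^{1/2}`. -/
theorem HasMSIntegral.sqrt_integral_sub_sq_le {y : ℝ → Ω → ℝ} (hy : ∀ u, MemLp (y u) 2 P)
    (hΓ : FiniteVariation (covFun P y)) {f f' g : ℝ → ℝ} {X X' : Ω → ℝ}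
    (h : HasMSIntegral P y f X) (h' : HasMSIntegral P y f' X') (hg : Continuous g)
    (hgfin : varIntegral (covFun P y) (fun u v => g u * g v) ≠ ⊤) {C : ℝ} (hC : 0 ≤ C)
    (hff' : ∀ u, |f u - f' u| ≤ C * g u) :
    √(∫ ω, (X - X') ω ^ 2 ∂P) ≤
      C * √(varIntegral (covFun P y) (fun u v => g u * g v)).toReal := by
  obtain ⟨v, hv0, hv⟩ : ∃ v : ℝ, 0 ≤ v ∧
      varIntegral (covFun P y) (fun u v => g u * g v) = ENNReal.ofReal v :=
    ⟨_, ENNReal.toReal_nonneg, (ENNReal.ofReal_toReal hgfin).symm⟩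
  obtain ⟨V, hV0, hV⟩ : ∃ V : ℝ, 0 ≤ V ∧ varIntegral (covFun P y) (fun _ _ => 1) =
    ENNReal.ofReal V := ⟨_, ENNReal.toReal_nonneg, (ENNReal.ofReal_toReal hΓ).symm⟩
  rw [hv, ENNReal.toReal_ofReal hv0]
  -- η bounds both the mean-square errors of the two Stieltjes sums and the oscillation of g(u)g(v)
  -- on the cells; it tends to 0 at the end.
  have key : ∀ η : ℝ, 0 < η → √(∫ ω, (X - X') ω ^ 2 ∂P) ≤ 2 * η + √(C ^ 2 * (v + η * V)) := by
    intro η hη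
    obtain ⟨a, b, δ, hab, hδ, hs⟩ := h.exists_delta hy h' (ENNReal.ofReal_pos.mpr hη)
    have hcont : Continuous fun q : ℝ × ℝ => g q.1 * g q.2 := by fun_prop
    have huc := (isCompact_Icc.prod isCompact_Icc :
      IsCompact (Icc a b ×ˢ Icc a b)).uniformContinuousOn_of_continuous hcont.continuousOn
    obtain ⟨δ', hδ', huc⟩ := Metric.uniformContinuousOn_iff.mp huc η hη
    obtain ⟨n, p, hpm, hp0, hpn, hpI, hpδ⟩ := exists_partition hab (lt_min hδ hδ')
    obtain ⟨h1, h2⟩ := hs n p p hp0 hpn fun i _ =>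
      ⟨hpm i.le_succ, (hpδ i).trans_le (min_le_left _ _), le_rfl, hpm i.le_succ⟩
    have hcell : ∀ i, ∀ u ∈ Icc (p i) (p (i + 1)), u ∈ Icc a b ∧ dist (p i) u < δ' := by
      intro i u hu
      refine ⟨⟨(hpI i).1.trans hu.1, hu.2.trans (hpI (i + 1)).2⟩, ?_⟩
      rw [Real.dist_eq, abs_sub_comm, abs_of_nonneg (sub_nonneg.mpr hu.1)]
      linarith [hpδ i, min_le_right δ δ', hu.2]
    have hcell2 : ∀ i j, ∀ u ∈ Icc (p i) (p (i + 1)), ∀ v ∈ Icc (p j) (p (j + 1)),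
        g (p i) * g (p j) ≤ g u * g v + η := fun i j u hu v hv => by
      have hd : dist (p i, p j) (u, v) < δ' := by
        rw [Prod.dist_eq]
        exact max_lt (hcell i u hu).2 (hcell j v hv).2
      have := huc (p i, p j) ⟨hpI i, hpI j⟩ (u, v) ⟨(hcell i u hu).1, (hcell j v hv).1⟩ hd
      rw [Real.dist_eq] at this
      linarith [(abs_lt.mp this).2]
    have hvar := ofReal_sum_le_varIntegral (covFun P y) (fun u v => g u * g v) hpm hpm n n hcell2
    rw [hv, hV, ← ENNReal.ofReal_mul hη.le, ← ENNReal.ofReal_add hv0 (mul_nonneg hη.le hV0),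
      ENNReal.ofReal_le_ofReal_iff (add_nonneg hv0 (mul_nonneg hη.le hV0))] at hvar
    set S := stieltjesSum y f p p n
    set S' := stieltjesSum y f' p p n
    have hSS : S - S' = stieltjesSum y (fun u => f u - f' u) p p n := by
      ext ω
      simp only [S, S', Pi.sub_apply, stieltjesSum_apply, ← Finset.sum_sub_distrib, sub_mul]
    have hL : MemLp S 2 P := memLp_stieltjesSum hy _ _ _ _
    have hL' : MemLp S' 2 P := memLp_stieltjesSum hy _ _ _ _
    have hsq : ∫ ω, (S - S') ω ^ 2 ∂P ≤ C ^ 2 * (v + η * V) := by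
      rw [hSS, integral_stieltjesSum_sq hy]
      refine le_trans ?_ (mul_le_mul_of_nonneg_left hvar (sq_nonneg C))
      rw [Finset.mul_sum]
      refine Finset.sum_le_sum fun i _ => ?_
      rw [Finset.mul_sum]
      refine Finset.sum_le_sum fun j _ => (le_abs_self _).trans ?_
      rw [abs_mul, abs_mul]
      calc _ ≤ (C * g (p i)) * (C * g (p j)) *
            |rectIncr (covFun P y) (p i) (p (i + 1)) (p j) (p (j + 1))| := by
            gcongr
            · exact (abs_nonneg _).trans (hff' _)
            · exact hff' _
            · exact hff' _
        _ = _ := by ring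
    have hLp := sqrt_integral_sq (hL.sub hL')
    rw [sqrt_integral_sq (h.1.sub h'.1)]
    refine ENNReal.toReal_le_of_le_ofReal (by positivity) ?_
    have e : X - X' = (S - S') - ((S - X) - (S' - X')) := by abel
    calc eLpNorm (X - X') 2 P ≤
          eLpNorm (S - S') 2 P + (eLpNorm (S - X) 2 P + eLpNorm (S' - X') 2 P) := by
          rw [e]
          refine (eLpNorm_sub_le (hL.sub hL').1 ((hL.sub h.1).sub (hL'.sub h'.1)).1
            (by norm_num)).trans ?_
          gcongr
          exact eLpNorm_sub_le (hL.sub h.1).1 (hL'.sub h'.1).1 (by norm_num)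
      _ ≤ ENNReal.ofReal √(C ^ 2 * (v + η * V)) + (ENNReal.ofReal η + ENNReal.ofReal η) := by
          gcongr
          rw [← ENNReal.ofReal_toReal (hL.sub hL').2.ne, ← hLp]
          exact ENNReal.ofReal_le_ofReal (Real.sqrt_le_sqrt hsq)
      _ = _ := by
          rw [← ENNReal.ofReal_add hη.le hη.le, ← ENNReal.ofReal_add (by positivity) (by positivity)]
          ring_nf
  have hc : Continuous fun η : ℝ => 2 * η + √(C ^ 2 * (v + η * V)) := by fun_prop
  have ht := hc.continuousWithinAt (s := Ioi 0) (x := 0)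
  refine (ge_of_tendsto ht (eventually_nhdsWithin_of_forall key)).trans_eq ?_
  simp [Real.sqrt_mul (sq_nonneg C), Real.sqrt_sq hC]

end Stieltjes

/-! ### The entropy integral -/

section Entropy

variable {φ Z : ℝ → ℝ} {u₀ : ℝ}

/-- The integrand of the entropy integral of a rectangle with half-sides `A` and `B`. -/
noncomputable def entropyFun (φ Z : ℝ → ℝ) (u₀ K A B s : ℝ) : ℝ :=
  Psi φ (Real.log (A * (incInv Z (K / s) - u₀) + 1) + Real.log (B * (incInv Z (K / s) - u₀) + 1))

theorem measurable_entropyFun (hφ : IsNFunction φ) (hZ : IsAdmissible φ Z u₀) (K A B : ℝ) :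
    Measurable (entropyFun φ Z u₀ K A B) := by
  have h1 := hφ.monotone_psi.measurable
  have h2 := (monotone_incInv hZ.tendsto).measurable
  have h3 : Measurable fun s => incInv Z (K / s) := h2.comp (measurable_const.div measurable_id)
  unfold entropyFun
  exact h1.comp (by fun_prop)

theorem log_le_abs (x : ℝ) : Real.log x ≤ |x| := by
  rw [← Real.log_abs]
  exact Real.log_le_self (abs_nonneg x)

theorem intervalIntegrable_entropyFun (hφ : IsNFunction φ) (hZ : IsAdmissible φ Z u₀)
    {K A B d : ℝ} (hK : 0 < K) (hA : 0 ≤ A) (hB : 0 ≤ B) (hd : 0 < d) :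
    IntervalIntegrable (entropyFun φ Z u₀ K A B) volume 0 d := by
  have hu := hZ.u₀_nonneg
  have hmeas := measurable_entropyFun hφ hZ K A B
  have hnn : ∀ s, 0 ≤ entropyFun φ Z u₀ K A B s := fun s => hφ.psi_nonneg _
  obtain ⟨ε, hε, hint⟩ := hZ.integrable
  -- Once w ≥ w₀, (Aw + 1)(Bw + 1) ≤ w₀w² ≤ w³, so near 0 the integrand is at most 3Ψ(ln w),
  -- integrable by admissibility after rescaling by K.
  set w₀ := (A + 1) * (B + 1) with hw₀
  have hw₀1 : 1 ≤ w₀ := by rw [hw₀]; nlinarith [mul_nonneg hA hB]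
  have hZw : 0 < Z (w₀ + u₀) := hZ.pos _ (by linarith)
  set s₁ := min (K / Z (w₀ + u₀)) (ε * K) / 2 with hs₁
  have hs₁0 : 0 < s₁ := half_pos (lt_min (by positivity) (by positivity))
  have hs₁K : s₁ < K / Z (w₀ + u₀) := (half_lt_self (lt_min (by positivity) (by positivity))).trans_le
    (min_le_left _ _)
  have hs₁ε : s₁ ≤ ε * K := (half_lt_self (lt_min (by positivity) (by positivity))).le.trans
    (min_le_right _ _)
  have hI1 : IntervalIntegrable (entropyFun φ Z u₀ K A B) volume 0 s₁ := by
    have h1 : IntervalIntegrable (fun s => Psi φ (Real.log (incInv Z (1 / s) - u₀))) volume 0 ε :=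
      (intervalIntegrable_iff_integrableOn_Ioc_of_le hε.le).mpr hint
    have h2 := h1.comp_mul_right (c := K⁻¹)
    rw [zero_div, div_inv_eq_mul] at h2
    have h3 := (h2.mono_set (c := 0) (d := s₁) (by
      rw [uIcc_of_le hs₁0.le, uIcc_of_le (by positivity)]
      exact Icc_subset_Icc_right hs₁ε)).const_mul 3
    refine h3.mono_fun' hmeas.aestronglyMeasurable ?_
    refine (ae_restrict_iff' measurableSet_uIoc).mpr (Eventually.of_forall fun s hs => ?_)
    rw [uIoc_of_le hs₁0.le] at hs
    beta_reduce
    rw [Real.norm_of_nonneg (hnn s)]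
    have hKs : 1 / (s * K⁻¹) = K / s := by
      have := hs.1.ne'
      field_simp
    simp only [hKs]
    have hz : w₀ + u₀ ≤ incInv Z (K / s) := by
      refine le_incInv hZ.tendsto hZ.monotoneOn (by linarith) ?_
      rw [lt_div_iff₀ hs.1, mul_comm, ← lt_div_iff₀ hZw]
      exact hs.2.trans_lt hs₁K
    set w := incInv Z (K / s) - u₀ with hw
    have hww : w₀ ≤ w := by linarith
    have hw1 : 1 ≤ w := hw₀1.trans hww
    have hAw : 0 < A * w + 1 := by positivity
    have hBw : 0 < B * w + 1 := by positivity
    have hprod : (A * w + 1) * (B * w + 1) ≤ w ^ 3 := by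
      calc (A * w + 1) * (B * w + 1) ≤ ((A + 1) * w) * ((B + 1) * w) := by
            gcongr <;> linarith
        _ = w₀ * w ^ 2 := by rw [hw₀]; ring
        _ ≤ w * w ^ 2 := by gcongr
        _ = w ^ 3 := by ring
    have hlog : Real.log (A * w + 1) + Real.log (B * w + 1) ≤ 3 * Real.log w := by
      rw [← Real.log_mul hAw.ne' hBw.ne']
      refine (Real.log_le_log (by positivity) hprod).trans_eq ?_
      rw [Real.log_pow]
      norm_num
    exact (hφ.monotone_psi hlog).trans (hφ.psi_three_mul_le (Real.log_nonneg hw1))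
  -- Away from 0 a constant bound suffices. The difference with u₀ may be negative here, and
  -- `Real.log` then sees the absolute value, whence `log_le_abs`.
  have hI2 : IntervalIntegrable (entropyFun φ Z u₀ K A B) volume s₁ d := by
    set m := min s₁ d with hm
    have hm0 : 0 < m := lt_min hs₁0 hd
    set M := incInv Z (K / m)
    have hM : 0 ≤ M := incInv_nonneg _ _
    refine (intervalIntegrable_const (c := Psi φ ((A * (M + u₀) + 1) + (B * (M + u₀) + 1)))).mono_fun'
      hmeas.aestronglyMeasurable ?_
    refine (ae_restrict_iff' measurableSet_uIoc).mpr (Eventually.of_forall fun s hs => ?_)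
    beta_reduce
    rw [Real.norm_of_nonneg (hnn s)]
    have hms : m ≤ s := hs.1.le
    have hz : incInv Z (K / s) ≤ M := monotone_incInv hZ.tendsto (by gcongr)
    have hz0 := incInv_nonneg Z (K / s)
    have habs : |incInv Z (K / s) - u₀| ≤ M + u₀ := abs_le.mpr ⟨by linarith, by linarith⟩
    have hbd : ∀ C : ℝ, 0 ≤ C → Real.log (C * (incInv Z (K / s) - u₀) + 1) ≤ C * (M + u₀) + 1 :=
      fun C hC => by
        refine (log_le_abs _).trans ((abs_add_le _ _).trans ?_)
        rw [abs_mul, abs_of_nonneg hC, abs_one]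
        gcongr
    exact hφ.monotone_psi (add_le_add (hbd A hA) (hbd B hB))
  exact hI1.trans hI2

/-- The intervals [εθ^{n+2}, εθ^{n+1}] tile (0, θε], and the n-th has length θ(1-θ)·εθ^n. This is
the source of the factor 1/(θ(1-θ)). -/
theorem sum_le_integral_geometric {F : ℝ → ℝ} {c : ℕ → ℝ} {ε θ : ℝ} (hε : 0 < ε) (hθ0 : 0 < θ)
    (hθ1 : θ < 1) (hF : ∀ r, 0 ≤ F r) (hi : IntervalIntegrable F volume 0 (θ * ε))
    (hc : ∀ n, ∀ r, 0 < r → r ≤ ε * θ ^ (n + 1) → c n ≤ F r) (m : ℕ) :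
    ∑ n ∈ Finset.range m, ε * θ ^ n * c n ≤ (∫ r in (0 : ℝ)..(θ * ε), F r) / (θ * (1 - θ)) := by
  have h1θ : 0 < 1 - θ := sub_pos.mpr hθ1
  have hsub : ∀ n : ℕ, ε * θ ^ (n + 1) ∈ uIcc 0 (θ * ε) := fun n => by
    rw [uIcc_of_le (by positivity)]
    refine ⟨by positivity, ?_⟩
    rw [pow_succ, mul_comm θ ε, ← mul_assoc, mul_right_comm]
    exact mul_le_of_le_one_right (by positivity) (pow_le_one₀ hθ0.le hθ1.le)
  have hii : ∀ x ∈ uIcc 0 (θ * ε), ∀ y ∈ uIcc 0 (θ * ε), IntervalIntegrable F volume x y :=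
    fun x hx y hy => hi.mono_set (uIcc_subset_uIcc hx hy)
  have key : ∀ m : ℕ, θ * (1 - θ) * ∑ n ∈ Finset.range m, ε * θ ^ n * c n ≤
      ∫ r in (ε * θ ^ (m + 1))..(θ * ε), F r := by
    intro m
    induction m with
    | zero => simp [mul_comm]
    | succ m ih =>
      rw [Finset.sum_range_succ, mul_add, ← intervalIntegral.integral_add_adjacent_intervals
        (hii _ (hsub (m + 1)) _ (hsub m)) (hii _ (hsub m) _ right_mem_uIcc), add_comm]
      refine add_le_add ?_ ih
      have hle : ε * θ ^ (m + 1 + 1) ≤ ε * θ ^ (m + 1) := by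
        gcongr ε * ?_
        exact pow_le_pow_of_le_one hθ0.le hθ1.le (Nat.le_succ _)
      have h1 := intervalIntegral.integral_mono_on hle intervalIntegrable_const
        (hii _ (hsub (m + 1)) _ (hsub m))
        fun r hr => hc m r ((by positivity : 0 < ε * θ ^ (m + 1 + 1)).trans_le hr.1) hr.2
      rw [intervalIntegral.integral_const, smul_eq_mul] at h1
      refine le_trans (le_of_eq ?_) h1
      ring
  rw [le_div_iff₀ (by positivity), mul_comm]
  refine (key m).trans ?_
  rw [← intervalIntegral.integral_add_adjacent_intervals (hii _ left_mem_uIcc _ (hsub m))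
    (hii _ (hsub m) _ right_mem_uIcc)]
  exact le_add_of_nonneg_left (intervalIntegral.integral_nonneg (by positivity) fun r _ => hF r)

/-- A net of an interval. -/
theorem exists_net_Icc {p q w : ℝ} (hpq : p ≤ q) (hw : 0 ≤ w) :
    ∃ S : Finset ℝ, S.Nonempty ∧ (∀ s ∈ S, s ∈ Icc p q) ∧ (S.card : ℝ) ≤ (q - p) / 2 * w + 1 ∧
      ∀ x ∈ Icc p q, ∃ s ∈ S, w * |x - s| ≤ 1 := by
  classical
  set h := (q - p) / 2 with hh
  have hh0 : 0 ≤ h := by rw [hh]; linarith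
  -- The net consists of the midpoints of n equal subintervals of half-length d = h/n, and n ≥ hw
  -- gives wd ≤ 1.
  set n := ⌊h * w⌋₊ + 1 with hn
  have hn0 : (0 : ℝ) < n := by rw [hn]; positivity
  have hnle : (n : ℝ) ≤ h * w + 1 := by
    rw [hn]; push_cast
    linarith [Nat.floor_le (mul_nonneg hh0 hw)]
  have hnlt : h * w ≤ n := by
    rw [hn]; push_cast
    exact (Nat.lt_floor_add_one _).le
  set d := h / n with hd
  have hd0 : 0 ≤ d := by positivity
  have hdn : d * n = h := by rw [hd]; field_simp
  have hwd : w * d ≤ 1 := by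
    rw [hd, mul_div_assoc', div_le_one hn0]; linarith
  set g : ℕ → ℝ := fun i => p + (2 * i + 1) * d with hg
  refine ⟨(Finset.range n).image g, by simp [hn], ?_, ?_, ?_⟩
  · simp only [Finset.mem_image, Finset.mem_range]
    rintro _ ⟨i, hi, rfl⟩
    have hi' : (i : ℝ) + 1 ≤ n := by exact_mod_cast hi
    have h1 : (2 * i + 1 : ℝ) * d ≤ 2 * n * d := by gcongr; linarith
    refine ⟨by simp only [hg]; linarith [show (0 : ℝ) ≤ (2 * i + 1) * d by positivity], ?_⟩
    simp only [hg]
    linarith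
  · refine le_trans ?_ hnle
    exact_mod_cast Finset.card_image_le.trans (by simp)
  · intro x hx
    rcases hd0.eq_or_lt with h0 | hd0
    · have hpq' : p = q := by rw [← h0, zero_mul] at hdn; linarith
      refine ⟨g 0, Finset.mem_image_of_mem _ (by simp [hn]), ?_⟩
      have hxp : x = p := le_antisymm (hpq' ▸ hx.2) hx.1
      simp [hg, ← h0, hxp]
    · have hy0 : 0 ≤ (x - p) / (2 * d) := div_nonneg (by linarith [hx.1]) (by positivity)
      set j := ⌊(x - p) / (2 * d)⌋₊ with hj
      have hj1 : (j : ℝ) * (2 * d) ≤ x - p := by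
        rw [← le_div_iff₀ (by positivity)]; exact Nat.floor_le hy0
      have hj2 : x - p ≤ (j + 1) * (2 * d) := by
        rw [← div_le_iff₀ (by positivity)]; exact (Nat.lt_floor_add_one _).le
      have hdist : ∀ i : ℕ, (i : ℝ) * (2 * d) ≤ x - p → x - p ≤ (i + 1) * (2 * d) →
          w * |x - g i| ≤ 1 := fun i h1 h2 => by
        have : |x - g i| ≤ d := by
          simp only [hg]
          exact abs_le.mpr ⟨by linarith, by linarith⟩
        exact (mul_le_mul_of_nonneg_left this hw).trans hwd
      rcases lt_or_ge j n with hjn | hjn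
      · exact ⟨g j, Finset.mem_image_of_mem _ (by simpa using hjn), hdist j hj1 hj2⟩
      -- Only the right endpoint of the interval lands here; it belongs to the last subinterval, of
      -- index n - 1.
      · refine ⟨g ⌊h * w⌋₊, Finset.mem_image_of_mem _ (by simp [hn]), hdist _ ?_ ?_⟩
        · refine le_trans ?_ hj1
          gcongr
          omega
        · have : ((⌊h * w⌋₊ : ℝ) + 1) = n := by rw [hn]; push_cast; ring
          rw [this]
          linarith [hx.2]

end Entropy

/-! ### The supremum over a rectangle -/

section Rectangle

variable {Ω : Type*} [MeasurableSpace Ω] {P : Measure Ω} [IsProbabilityMeasure P] {φ Z : ℝ → ℝ}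
  {u₀ : ℝ}

theorem measure_sup_rectangle_ge_le (hφ : IsNFunction φ) (hZ : IsAdmissible φ Z u₀)
    {A b b' K ε θ u : ℝ} (hA : 0 ≤ A) (hb : b ≤ b') (hK : 0 < K) (hε : 0 < ε) (hθ0 : 0 < θ)
    (hθ1 : θ < 1) (X : ℝ × ℝ → Ω → ℝ)
    (hX : ∀ q ∈ Icc (-A) A ×ˢ Icc b b', ExpBound φ P ε (X q))
    (hincr : ∀ w, 0 ≤ w → 0 < Z (w + u₀) → ∀ q ∈ Icc (-A) A ×ˢ Icc b b',
      ∀ q' ∈ Icc (-A) A ×ˢ Icc b b', w * |q.1 - q'.1| ≤ 1 → w * |q.2 - q'.2| ≤ 1 →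
        ExpBound φ P (K / Z (w + u₀)) (X q - X q'))
    (hcont : ∀ᵐ ω ∂P, ContinuousOn (fun q => X q ω) (Icc (-A) A ×ˢ Icc b b'))
    (hu : 4 / (θ * (1 - θ)) * (∫ s in (0 : ℝ)..(θ * ε), entropyFun φ Z u₀ K A ((b' - b) / 2) s) ≤ u) :
    P {ω | ∀ v < u, ∃ q ∈ Icc (-A) A ×ˢ Icc b b', v < |X q ω|} ≤
      ENNReal.ofReal (2 * Real.exp (-youngConj φ (u * (1 - θ) / (2 * ε)))) := by
  classical
  have hu₀ := hZ.u₀_nonneg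
  have h1θ : 0 < 1 - θ := sub_pos.mpr hθ1
  set V := Icc (-A) A ×ˢ Icc b b' with hV
  set B := (b' - b) / 2 with hB
  have hB0 : 0 ≤ B := by rw [hB]; linarith
  have hFnn : ∀ s, 0 ≤ entropyFun φ Z u₀ K A B s := fun s => hφ.psi_nonneg _
  set r : ℕ → ℝ := fun n => ε * θ ^ (n + 1) with hr
  have hr0 : ∀ n, 0 < r n := fun n => by positivity
  -- The resolution at which increments have constant K/Z(w_n + u₀) ≤ r_n = εθ^{n+1}. The truncation
  -- at 0 covers Z⁻¹(K/r_n) < u₀.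
  set w : ℕ → ℝ := fun n => max 0 (incInv Z (K / r n) - u₀) with hw
  have hw0 : ∀ n, 0 ≤ w n := fun n => le_max_left _ _
  have hZw : ∀ n, K / r n ≤ Z (w n + u₀) := fun n => by
    refine (le_apply_incInv hZ.cont hZ.tendsto (K / r n)).trans
      (hZ.monotoneOn (incInv_nonneg _ _) (add_nonneg (hw0 n) hu₀) ?_)
    linarith [le_max_right 0 (incInv Z (K / r n) - u₀)]
  have hZw0 : ∀ n, 0 < Z (w n + u₀) := fun n => (div_pos hK (hr0 n)).trans_le (hZw n)
  choose S₁ hS₁ne hS₁mem hS₁card hS₁net using fun n =>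
    exists_net_Icc (show -A ≤ A by linarith) (hw0 n)
  choose S₂ hS₂ne hS₂mem hS₂card hS₂net using fun n => exists_net_Icc hb (hw0 n)
  set S : ℕ → Finset (ℝ × ℝ) := fun n => S₁ n ×ˢ S₂ n with hS
  have hSV : ∀ n, ∀ q ∈ S n, q ∈ V := fun n q hq => by
    rw [hS, Finset.mem_product] at hq
    exact ⟨hS₁mem n _ hq.1, hS₂mem n _ hq.2⟩
  have hSnet : ∀ n, ∀ q ∈ V, ∃ s ∈ S n, w n * |q.1 - s.1| ≤ 1 ∧ w n * |q.2 - s.2| ≤ 1 := by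
    intro n q hq
    obtain ⟨s, hs, hs'⟩ := hS₁net n _ hq.1
    obtain ⟨t, ht, ht'⟩ := hS₂net n _ hq.2
    exact ⟨(s, t), Finset.mk_mem_product hs ht, hs', ht'⟩
  set H : ℕ → ℝ := fun n => Real.log (A * w n + 1) + Real.log (B * w n + 1) with hH
  have hAw : ∀ n, 1 ≤ A * w n + 1 := fun n => by linarith [mul_nonneg hA (hw0 n)]
  have hBw : ∀ n, 1 ≤ B * w n + 1 := fun n => by linarith [mul_nonneg hB0 (hw0 n)]
  have hH0 : ∀ n, 0 ≤ H n := fun n =>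
    add_nonneg (Real.log_nonneg (hAw n)) (Real.log_nonneg (hBw n))
  have hSH : ∀ n, ((S n).card : ℝ) ≤ Real.exp (H n) := fun n => by
    rw [hH, Real.exp_add, Real.exp_log (by linarith [hAw n]), Real.exp_log (by linarith [hBw n]),
      hS, Finset.card_product]
    push_cast
    refine mul_le_mul ((hS₁card n).trans_eq ?_) (hS₂card n) (by positivity) (by linarith [hAw n])
    ring
  have hstep : ∀ n, ∀ q ∈ S (n + 1), ∃ v ∈ S n, ExpBound φ P (ε * θ ^ (n + 1)) (X q - X v) := by
    intro n q hq
    obtain ⟨s, hs, h1, h2⟩ := hSnet n q (hSV _ q hq)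
    refine ⟨s, hs, (hincr (w n) (hw0 n) (hZw0 n) q (hSV _ q hq) s (hSV _ s hs) h1 h2).mono hφ ?_⟩
    refine abs_le_abs_of_nonneg (div_pos hK (hZw0 n)).le ?_
    have := hZw n
    rw [div_le_iff₀ (hr0 n)] at this
    rw [div_le_iff₀ (hZw0 n)]
    simp only [hr] at this
    linarith
  have hPsi : ∀ n, ∀ s, 0 < s → s ≤ ε * θ ^ (n + 1) →
      Psi φ (H n) ≤ entropyFun φ Z u₀ K A B s := by
    intro n s hs hsr
    have hz : incInv Z (K / r n) ≤ incInv Z (K / s) :=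
      monotone_incInv hZ.tendsto (div_le_div_of_nonneg_left hK.le hs hsr)
    -- In the first case the logarithms in the integrand are not controlled, but w_n = 0 makes H_n =
    -- 0 and Ψ ≥ 0 suffices.
    rcases le_total (incInv Z (K / s)) u₀ with h | h
    · have : w n = 0 := max_eq_left (by linarith)
      have hHn : H n = 0 := by simp [hH, this]
      rw [hHn, hφ.psi_of_nonpos le_rfl]
      exact hFnn s
    · have hwz : w n ≤ incInv Z (K / s) - u₀ := max_le (by linarith) (by linarith)
      refine hφ.monotone_psi (add_le_add ?_ ?_)
      · exact Real.log_le_log (by linarith [hAw n]) (by gcongr)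
      · exact Real.log_le_log (by linarith [hBw n]) (by gcongr)
  have hJ := sum_le_integral_geometric (c := fun n => Psi φ (H n)) hε hθ0 hθ1 hFnn
    (intervalIntegrable_entropyFun hφ hZ hK hA hB0 (by positivity)) hPsi
  set I := ∫ s in (0 : ℝ)..(θ * ε), entropyFun φ Z u₀ K A B s with hI
  have hI0 : 0 ≤ I := intervalIntegral.integral_nonneg (by positivity) fun s _ => hFnn s
  have hJu : 4 * (I / (θ * (1 - θ))) ≤ u := by
    refine le_trans (le_of_eq ?_) hu
    ring
  have hu0 : 0 ≤ u := le_trans (by positivity) hJu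
  refine measure_le_exp_neg_youngConj hφ hε hθ1 hu0 hJu fun l hl v hv => ?_
  refine le_trans (measure_mono_ae ?_) (measure_exists_gt_le hφ X S
    (fun n => (hS₁ne n).product (hS₂ne n)) H hH0 hSH hε hθ0 hθ1
    (fun q hq => hX q (hSV 0 q hq)) hstep hJ hl v)
  filter_upwards [hcont] with ω hω hmem
  obtain ⟨q, hq, hvq⟩ := hmem v hv
  -- By continuity |X| > v persists near q, and a sufficiently fine net has a point there, since w_n
  -- grows without bound as r_n tends to 0.
  have hnhds : ∀ᶠ s in 𝓝[V] q, v < |X s ω| := (hω q hq).abs.eventually_const_lt hvq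
  obtain ⟨δ, hδ, hball⟩ := Metric.mem_nhdsWithin_iff.mp hnhds
  set M := u₀ + 2 / δ with hM
  have hM0 : 0 ≤ M := by positivity
  have hZM := hZ.nonneg hM0
  obtain ⟨n, hn⟩ := exists_pow_lt_of_lt_one (show 0 < K / (ε * (Z M + 1)) by positivity) hθ1
  have hrn : Z M < K / r n := by
    have h1 : r n ≤ ε * θ ^ n := by
      simp only [hr]
      gcongr ε * ?_
      exact pow_le_pow_of_le_one hθ0.le hθ1.le (Nat.le_succ _)
    have h2 : θ ^ n * (ε * (Z M + 1)) < K := (lt_div_iff₀ (by positivity)).mp hn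
    rw [lt_div_iff₀ (hr0 n)]
    calc Z M * r n ≤ (Z M + 1) * (ε * θ ^ n) := by gcongr; linarith
      _ < K := by linarith
  have hwn : 2 / δ ≤ w n := by
    have := le_incInv hZ.tendsto hZ.monotoneOn hM0 hrn
    exact le_trans (by linarith) (le_max_right _ _)
  have hwn0 : 0 < w n := lt_of_lt_of_le (by positivity) hwn
  obtain ⟨s, hs, h1, h2⟩ := hSnet n q hq
  have hclose : ∀ x : ℝ, w n * |x| ≤ 1 → |x| < δ := fun x hx => by
    have h3 : 2 / δ * |x| ≤ 1 := (mul_le_mul_of_nonneg_right hwn (abs_nonneg x)).trans hx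
    rw [div_mul_eq_mul_div, div_le_one hδ] at h3
    linarith [abs_nonneg x]
  refine ⟨n, s, hs, hball ⟨?_, hSV n s hs⟩⟩
  rw [Metric.mem_ball, dist_comm, Prod.dist_eq, Real.dist_eq, Real.dist_eq]
  exact max_lt (hclose _ h1) (hclose _ h2)

/-- The degenerate case: all values of the field on the set coincide almost surely. -/
theorem measure_sup_const_ge_le (hφ : IsNFunction φ) {ε θ u : ℝ} (hε : 0 < ε) (hθ0 : 0 < θ)
    (hθ1 : θ < 1) (hu : 0 ≤ u) {T : Type*} (X : T → Ω → ℝ) {D : Set T} (hD : D.Countable) {q : T}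
    (hX : ExpBound φ P ε (X q)) (hconst : ∀ q' ∈ D, X q' =ᵐ[P] X q) :
    P {ω | ∀ v < u, ∃ q ∈ D, v < |X q ω|} ≤
      ENNReal.ofReal (2 * Real.exp (-youngConj φ (u * (1 - θ) / (2 * ε)))) := by
  refine measure_le_exp_neg_youngConj hφ hε hθ1 hu (J := 0) (by simpa using hu)
    fun l hl v hv => ?_
  have hae : ∀ᵐ ω ∂P, ∀ q' ∈ D, X q' ω = X q ω := (ae_ball_iff hD).mpr hconst
  refine le_trans (measure_mono_ae ?_) (measure_exists_gt_le hφ X (fun _ => {q})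
    (fun _ => Finset.singleton_nonempty q) (fun _ => 0) (fun _ => le_rfl) (by simp) hε hθ0 hθ1
    (by simpa using hX) (fun n u' hu' => ⟨q, by simp, ?_⟩) (J := 0)
    (by simp [hφ.psi_of_nonpos le_rfl]) hl v)
  · filter_upwards [hae] with ω hω hmem
    obtain ⟨q', hq', hv'⟩ := hmem v hv
    exact ⟨0, q, by simp, by rwa [hω q' hq'] at hv'⟩
  · rw [Finset.mem_singleton.mp hu', sub_self]
    exact .zero hφ _

end Rectangle

/-! ### The field on a rectangle -/

section Field

variable {Ω : Type*} [MeasurableSpace Ω] {P : Measure Ω} {φ Z : ℝ → ℝ} {u₀ : ℝ}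

theorem sqrt_integral_sq_le_add {X Y : Ω → ℝ} (hX : MemLp X 2 P) (hY : MemLp Y 2 P) :
    √(∫ ω, X ω ^ 2 ∂P) ≤ √(∫ ω, Y ω ^ 2 ∂P) + √(∫ ω, (X - Y) ω ^ 2 ∂P) := by
  rw [sqrt_integral_sq hX, sqrt_integral_sq hY, sqrt_integral_sq (hX.sub hY),
    ← ENNReal.toReal_add hY.2.ne (hX.sub hY).2.ne]
  refine ENNReal.toReal_mono (ENNReal.add_ne_top.mpr ⟨hY.2.ne, (hX.sub hY).2.ne⟩) ?_
  calc eLpNorm X 2 P = eLpNorm (Y + (X - Y)) 2 P := by rw [add_sub_cancel]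
    _ ≤ _ := eLpNorm_add_le hY.1 (hX.sub hY).1 (by norm_num)

theorem exists_pos_mul_abs_sub_le {p p' q q' : ℝ} : ∃ w : ℝ, 0 < w ∧
    ∀ x ∈ Icc p p' ×ˢ Icc q q', ∀ x' ∈ Icc p p' ×ˢ Icc q q',
      w * |x.1 - x'.1| ≤ 1 ∧ w * |x.2 - x'.2| ≤ 1 := by
  refine ⟨(|p' - p| + |q' - q| + 1)⁻¹, by positivity, fun x hx x' hx' => ?_⟩
  have h1 : |x.1 - x'.1| ≤ |p' - p| := by
    refine le_trans (abs_le.mpr ⟨?_, ?_⟩) (le_abs_self _) <;>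
      linarith [hx.1.1, hx.1.2, hx'.1.1, hx'.1.2]
  have h2 : |x.2 - x'.2| ≤ |q' - q| := by
    refine le_trans (abs_le.mpr ⟨?_, ?_⟩) (le_abs_self _) <;>
      linarith [hx.2.1, hx.2.2, hx'.2.1, hx'.2.2]
  rw [inv_mul_le_one₀ (by positivity), inv_mul_le_one₀ (by positivity)]
  constructor <;> linarith [abs_nonneg (p' - p), abs_nonneg (q' - q)]

/-- The tail of the supremum of a field with strictly sub-Gaussian increments over a countable
subset of a rectangle. -/
theorem field_rectangle_bound [IsProbabilityMeasure P] (hφ : IsNFunction φ)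
    (hZ : IsAdmissible φ Z u₀)
    {A b b' Cy CZ ε θ : ℝ} (hA : 0 ≤ A) (hb : b ≤ b') (hCZ : 0 ≤ CZ) (hθ0 : 0 < θ)
    (hθ1 : θ < 1) (X : ℝ × ℝ → Ω → ℝ) {D : Set (ℝ × ℝ)} (hD : D.Countable)
    (hDV : D ⊆ Icc (-A) A ×ˢ Icc b b')
    (hL : ∀ q ∈ Icc (-A) A ×ˢ Icc b b', MemLp (X q) 2 P)
    (hX : ∀ q ∈ Icc (-A) A ×ˢ Icc b b', 0 ≤ Cy * √(∫ ω, X q ω ^ 2 ∂P) ∧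
      ExpBound φ P (Cy * √(∫ ω, X q ω ^ 2 ∂P)) (X q))
    (hXX : ∀ q ∈ Icc (-A) A ×ˢ Icc b b', ∀ q' ∈ Icc (-A) A ×ˢ Icc b b',
      ExpBound φ P (Cy * √(∫ ω, (X q - X q') ω ^ 2 ∂P)) (X q - X q'))
    (hincr : ∀ w, 0 ≤ w → 0 < Z (w + u₀) → ∀ q ∈ Icc (-A) A ×ˢ Icc b b',
      ∀ q' ∈ Icc (-A) A ×ˢ Icc b b', w * |q.1 - q'.1| ≤ 1 → w * |q.2 - q'.2| ≤ 1 →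
        √(∫ ω, (X q - X q') ω ^ 2 ∂P) ≤ 2 / Z (w + u₀) * CZ)
    (hcont : ∀ᵐ ω ∂P, ContinuousOn (fun q => X q ω) (Icc (-A) A ×ˢ Icc b b'))
    (hε : ε = Cy * sSup ((fun q => √(∫ ω, X q ω ^ 2 ∂P)) '' (Icc (-A) A ×ˢ Icc b b'))) :
    0 ≤ ε ∧ ∀ u, 0 < u → 4 / (θ * (1 - θ)) *
      (∫ s in (0 : ℝ)..(θ * ε), entropyFun φ Z u₀ (2 * CZ * Cy) A ((b' - b) / 2) s) ≤ u →
      (ε = 0 → P {ω | ∀ v < u, ∃ q ∈ D, v < |X q ω|} = 0) ∧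
      (0 < ε → P {ω | ∀ v < u, ∃ q ∈ D, v < |X q ω|} ≤
        ENNReal.ofReal (2 * Real.exp (-youngConj φ (u * (1 - θ) / (2 * ε))))) := by
  have hu₀ := hZ.u₀_nonneg
  set V := Icc (-A) A ×ˢ Icc b b' with hV
  set σ : ℝ × ℝ → ℝ := fun q => √(∫ ω, X q ω ^ 2 ∂P) with hσ
  have hσ0 : ∀ q, 0 ≤ σ q := fun q => Real.sqrt_nonneg _
  -- With w this small any two points of the rectangle satisfy the increment hypothesis. This bounds
  -- σ, so that its `sSup` is genuine, and makes all values coincide almost surely when C_Z = 0.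
  obtain ⟨w, hw, hwV⟩ := @exists_pos_mul_abs_sub_le (-A) A b b'
  have hZw : 0 < Z (w + u₀) := hZ.pos _ (by linarith)
  have hq₀ : ((0, b) : ℝ × ℝ) ∈ V := ⟨⟨by simpa using hA, hA⟩, ⟨le_rfl, hb⟩⟩
  have hbdd : BddAbove (σ '' V) := by
    refine ⟨σ (0, b) + 2 / Z (w + u₀) * CZ, ?_⟩
    rintro _ ⟨q, hq, rfl⟩
    refine (sqrt_integral_sq_le_add (hL q hq) (hL _ hq₀)).trans (add_le_add le_rfl ?_)
    exact hincr w hw.le hZw q hq _ hq₀ (hwV q hq _ hq₀).1 (hwV q hq _ hq₀).2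
  have hsup0 : 0 ≤ sSup (σ '' V) := Real.sSup_nonneg (by rintro _ ⟨q, -, rfl⟩; exact hσ0 q)
  have hle : ∀ q ∈ V, Cy * σ q ≤ ε := fun q hq => by
    -- A negative Cy forces every σ to vanish, since Cy * σ is nonnegative; all cases then give the
    -- same bound.
    rcases le_or_gt Cy 0 with hC | hC
    · have h1 : Cy * σ q ≤ 0 := mul_nonpos_of_nonpos_of_nonneg hC (hσ0 q)
      rcases hC.eq_or_lt with h0 | hC'
      · rw [hε, h0, zero_mul, zero_mul]
      · have h2 : ∀ q ∈ V, σ q = 0 := fun q hq => by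
          have := (hX q hq).1
          have hz : σ q ≤ 0 := nonpos_of_mul_nonneg_right this hC'
          exact le_antisymm hz (hσ0 q)
        have h3 : sSup (σ '' V) ≤ 0 := Real.sSup_le (by
          rintro _ ⟨q, hq, rfl⟩; exact (h2 q hq).le) le_rfl
        rw [hε, le_antisymm h3 hsup0, h2 q hq]
    · rw [hε]
      exact mul_le_mul_of_nonneg_left (le_csSup hbdd (mem_image_of_mem _ hq)) hC.le
  have hε0 : 0 ≤ ε := (hX _ hq₀).1.trans (hle _ hq₀)
  have hXε : ∀ q ∈ V, ExpBound φ P ε (X q) := fun q hq =>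
    (hX q hq).2.mono hφ (abs_le_abs_of_nonneg (hX q hq).1 (hle q hq))
  refine ⟨hε0, fun u hu huI => ⟨fun hε0 => ?_, fun hε0 => ?_⟩⟩
  · have hae : ∀ᵐ ω ∂P, ∀ q ∈ D, X q ω = 0 := (ae_ball_iff hD).mpr fun q hq =>
      (hε0 ▸ hXε q (hDV hq)).ae_eq_zero hφ
    rw [measure_eq_zero_iff_ae_notMem]
    filter_upwards [hae] with ω hω hmem
    obtain ⟨q, hq, hlt⟩ := hmem 0 hu
    simp [hω q hq] at hlt
  · have hCy : 0 < Cy := by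
      by_contra! hC
      have := mul_nonpos_of_nonpos_of_nonneg hC hsup0
      rw [← hε] at this
      linarith
    rcases hCZ.eq_or_lt with h0 | hCZ0
    · refine measure_sup_const_ge_le hφ hε0 hθ0 hθ1 hu.le X hD (hXε _ hq₀) fun q hq => ?_
      have h1 := hincr w hw.le hZw q (hDV hq) _ hq₀ (hwV q (hDV hq) _ hq₀).1
        (hwV q (hDV hq) _ hq₀).2
      rw [← h0, mul_zero] at h1
      have h2 := hXX q (hDV hq) _ hq₀
      rw [le_antisymm h1 (Real.sqrt_nonneg _), mul_zero] at h2
      filter_upwards [h2.ae_eq_zero hφ] with ω hω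
      exact sub_eq_zero.mp hω
    · refine (measure_mono fun ω hω v hv => ?_).trans
        (measure_sup_rectangle_ge_le hφ hZ hA hb (by positivity) hε0 hθ0 hθ1 X hXε
          (fun w hw hZw q hq q' hq' h1 h2 => (hXX q hq q' hq').mono hφ ?_) hcont huI)
      · obtain ⟨q, hq, h⟩ := hω v hv
        exact ⟨q, hDV hq, h⟩
      · refine abs_le_abs_of_nonneg (by positivity) ?_
        calc _ ≤ Cy * (2 / Z (w + u₀) * CZ) := by gcongr; exact hincr w hw hZw q hq q' hq' h1 h2
          _ = _ := by ring

end Field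

/-! ### Gluing the rectangles -/

section Glue

variable {φ : ℝ → ℝ}

/-- xz = z + (x-1)z ≥ z + 2ρ(x-1) ≥ z + ρx ≥ z + u, the middle step using x ≥ 2; superadditivity
concludes. -/
theorem IsNFunction.youngConj_add_le_of_mul (hφ : IsNFunction φ) {x z ρ u : ℝ} (hρ : 1 < ρ)
    (hx : 2 ≤ x) (hz : 2 * ρ ≤ z) (hu : 0 < u) (hux : u ≤ ρ * x) :
    youngConj φ u + youngConj φ z ≤ youngConj φ (x * z) := by
  have hz0 : 0 < z := by linarith
  refine (hφ.youngConj_add_le hu hz0).trans (hφ.youngConj_mono (by positivity) ?_)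
  nlinarith [mul_le_mul_of_nonneg_right hz (show 0 ≤ x - 1 by linarith)]

theorem exists_mem_Icc_of_unbounded {b : ℕ → ℝ} {d t : ℝ} (hd : 0 < d) (hb0 : b 0 = 0)
    (hb : ∀ k, d ≤ b (k + 1) - b k) (ht : 0 ≤ t) : ∃ k, t ∈ Icc (b k) (b (k + 1)) := by
  classical
  have h1 : ∀ k : ℕ, k * d ≤ b k := fun k => by
    induction k with
    | zero => simp [hb0]
    | succ k ih => push_cast; linarith [hb k]
  have h2 : ∃ k, t < b k := by
    obtain ⟨k, hk⟩ := exists_nat_gt (t / d)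
    exact ⟨k, ((div_lt_iff₀ hd).mp hk).trans_le (h1 k)⟩
  have h3 := Nat.find_spec h2
  obtain ⟨k, hk⟩ : ∃ k, Nat.find h2 = k + 1 := by
    refine Nat.exists_eq_succ_of_ne_zero fun h0 => ?_
    rw [h0, hb0] at h3
    linarith
  exact ⟨k, not_lt.mp (Nat.find_min h2 (by omega)), by rw [← hk]; exact h3.le⟩

/-- The function `x ↦ ρ x` above the level `u₁`, `u₁` below it. -/
noncomputable def raise (u₁ ρ : ℝ≥0∞) (x : ℝ≥0∞) : ℝ≥0∞ := if x < u₁ then u₁ else ρ * x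

theorem measurable_raise (u₁ ρ : ℝ≥0∞) : Measurable (raise u₁ ρ) :=
  Measurable.ite measurableSet_Iio measurable_const (measurable_id.const_mul ρ)

/-- This strict gain yields the strict inequality for the field: the majorant is a supremum of
raised values, each above the value it controls. -/
theorem lt_raise {u₁ ρ x : ℝ≥0∞} (hu₁ : 0 < u₁) (hρ : 1 < ρ) (h : raise u₁ ρ x ≠ ⊤) :
    x < raise u₁ ρ x := by
  unfold raise at h ⊢
  split_ifs at h ⊢ with hx
  · exact hx
  · have hx0 : x ≠ 0 := (hu₁.trans_le (not_lt.mp hx)).ne'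
    have hxt : x ≠ ⊤ := by
      rintro rfl
      exact h (ENNReal.mul_top (one_pos.trans hρ).ne')
    calc x = 1 * x := (one_mul x).symm
      _ < ρ * x := ENNReal.mul_lt_mul_left hx0 hxt hρ

theorem le_of_lt_raise {u₁ ρ x u : ℝ≥0∞} (hu : u₁ ≤ u) (h : u < raise u₁ ρ x) :
    u₁ ≤ x ∧ u < ρ * x := by
  unfold raise at h
  split_ifs at h with hx
  · exact absurd h (not_lt.mpr hu)
  · exact ⟨not_lt.mp hx, h⟩

end Glue

/-! ### The random majorant of a field given on countably many pieces -/

section Majorant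

variable {Ω : Type*} [MeasurableSpace Ω] {P : Measure Ω} {φ : ℝ → ℝ}

theorem seriesTerm_nonneg (φ : ℝ → ℝ) (s θ c ε : ℝ) : 0 ≤ seriesTerm φ s θ c ε := by
  unfold seriesTerm
  split_ifs <;> positivity

theorem AU_nonneg (φ : ℝ → ℝ) (s θ : ℝ) (c ε : ℕ → ℝ) (u : ℝ) : 0 ≤ AU φ s θ c ε u :=
  mul_nonneg (Real.exp_pos _).le (tsum_nonneg fun _ => seriesTerm_nonneg _ _ _ _ _)

theorem IsNFunction.tendsto_AU (hφ : IsNFunction φ) {s : ℝ} (hs : 0 < s) (θ : ℝ) (c ε : ℕ → ℝ) :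
    Tendsto (AU φ s θ c ε) atTop (𝓝 0) := by
  have h1 : Tendsto (fun u => Real.exp (-youngConj φ (u / s))) atTop (𝓝 0) :=
    Real.tendsto_exp_neg_atTop_nhds_zero.comp
      (hφ.tendsto_youngConj.comp (tendsto_id.atTop_div_const hs))
  have h2 := h1.mul_const (∑' k, seriesTerm φ s θ (c k) (ε k))
  rwa [zero_mul] at h2

/-- The tail of the supremum over one piece, compared with a term of the series. -/
theorem measure_piece_le (hφ : IsNFunction φ) {E : Set Ω} {s θ c ε v u ρ : ℝ} (hs : 0 < s)
    (hc : 0 < c) (hε : 0 ≤ ε) (hρ : 1 < ρ)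
    (hy : 0 < ε → 2 * ρ ≤ s * c * (1 - θ) / (2 * ε)) (hu : 0 < u) (hv : 2 * s ≤ v)
    (huv : u ≤ ρ * v) (h0 : ε = 0 → P E = 0)
    (h1 : 0 < ε → P E ≤
      ENNReal.ofReal (2 * Real.exp (-youngConj φ (v * c * (1 - θ) / (2 * ε))))) :
    P E ≤ ENNReal.ofReal (2 * Real.exp (-youngConj φ (u / s)) * seriesTerm φ s θ c ε) := by
  rcases hε.eq_or_lt with h | h
  · rw [h0 h.symm]
    exact zero_le
  · refine (h1 h).trans (ENNReal.ofReal_le_ofReal ?_)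
    rw [seriesTerm, if_neg h.ne', mul_assoc 2, ← Real.exp_add]
    gcongr
    have key := hφ.youngConj_add_le_of_mul (x := v / s) (u := u / s) hρ
      (by rwa [le_div_iff₀ hs]) (hy h) (by positivity)
      (by rw [mul_div_assoc']; gcongr)
    have e : v / s * (s * c * (1 - θ) / (2 * ε)) = v * c * (1 - θ) / (2 * ε) := by field_simp
    rw [e] at key
    linarith

/-- The random variable majorizing a field given on a sequence of pieces. -/
theorem exists_majorant [IsProbabilityMeasure P] (hφ : IsNFunction φ) {T : Type*}
    [TopologicalSpace T] (X : T → Ω → ℝ) (V D : ℕ → Set T) (hD : ∀ k, (D k).Countable)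
    (hDV : ∀ k, D k ⊆ V k) (hVD : ∀ k, V k ⊆ closure (D k))
    (hX : ∀ k, ∀ q ∈ D k, AEMeasurable (X q) P)
    (hcont : ∀ᵐ ω ∂P, ∀ k, ContinuousOn (fun q => X q ω) (V k))
    {c ε I : ℕ → ℝ} {s θ : ℝ} (hc : ∀ k, 0 < c k) (hε : ∀ k, 0 ≤ ε k) (hθ0 : 0 < θ)
    (hθ1 : θ < 1) (hεc : BddAbove (range fun k => ε k / c k))
    (hI : BddAbove (range fun k => I k / c k))
    (hs : (⨆ k, 4 * ε k / (c k * (1 - θ))) < s)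
    (hsum : Summable fun k => seriesTerm φ s θ (c k) (ε k))
    (htail : ∀ k, ∀ u, 0 < u → 4 / (θ * (1 - θ)) * I k ≤ u →
      (ε k = 0 → P {ω | ∀ v < u, ∃ q ∈ D k, v < |X q ω|} = 0) ∧
      (0 < ε k → P {ω | ∀ v < u, ∃ q ∈ D k, v < |X q ω|} ≤
        ENNReal.ofReal (2 * Real.exp (-youngConj φ (u * (1 - θ) / (2 * ε k)))))) :
    ∃ ξ : Ω → ℝ, Measurable ξ ∧
      (∀ u : ℝ, 2 * s < u → (⨆ k, I k / c k) * (4 / (θ * (1 - θ))) < u →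
        P.real {ω | u < ξ ω} ≤ 2 * AU φ s θ c ε u) ∧
      ∀ᵐ ω ∂P, ∀ k, ∀ q ∈ V k, |X q ω| < ξ ω * c k := by
  have h1θ : 0 < 1 - θ := sub_pos.mpr hθ1
  set σ := ⨆ k, 4 * ε k / (c k * (1 - θ)) with hσ
  have hterm : ∀ k, 0 ≤ 4 * ε k / (c k * (1 - θ)) := fun k =>
    div_nonneg (by linarith [hε k]) (mul_nonneg (hc k).le h1θ.le)
  have hσbdd : BddAbove (range fun k => 4 * ε k / (c k * (1 - θ))) := by
    obtain ⟨M, hM⟩ := hεc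
    refine ⟨4 / (1 - θ) * M, ?_⟩
    rintro _ ⟨k, rfl⟩
    calc 4 * ε k / (c k * (1 - θ)) = 4 / (1 - θ) * (ε k / c k) := by field_simp
      _ ≤ _ := by gcongr; exact hM ⟨k, rfl⟩
  have hσ0 : 0 ≤ σ := Real.iSup_nonneg hterm
  have hs0 : 0 < s := hσ0.trans_lt hs
  -- A positive number below s and at least σ. The maximum with s/2 keeps ρ = s/τ meaningful when σ
  -- = 0.
  set τ := max σ (s / 2) with hτ
  have hτ0 : 0 < τ := (half_pos hs0).trans_le (le_max_right _ _)
  have hτs : τ < s := max_lt hs (half_lt_self hs0)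
  set ρ := s / τ with hρ
  have hρ1 : 1 < ρ := (one_lt_div hτ0).mpr hτs
  have hρ0 : 0 < ρ := one_pos.trans hρ1
  have hy : ∀ k, 0 < ε k → 2 * ρ ≤ s * c k * (1 - θ) / (2 * ε k) := fun k hk => by
    have h1 : 4 * ε k / (c k * (1 - θ)) ≤ τ := (le_ciSup hσbdd k).trans (le_max_left _ _)
    have hck := hc k
    rw [div_le_iff₀ (by positivity)] at h1
    rw [hρ, le_div_iff₀ (by positivity), mul_div_assoc', div_mul_eq_mul_div, div_le_iff₀ hτ0]
    nlinarith [mul_le_mul_of_nonneg_left h1 hs0.le]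
  set u₁ := max (2 * s) ((⨆ k, I k / c k) * (4 / (θ * (1 - θ)))) with hu₁
  have hu₁0 : 0 < u₁ := lt_of_lt_of_le (by positivity) (le_max_left _ _)
  set M : ℕ → Ω → ℝ≥0∞ := fun k ω => ⨆ q ∈ D k, ENNReal.ofReal |X q ω| with hM
  set ξ₀ : Ω → ℝ≥0∞ := fun ω =>
    ⨆ k, raise (ENNReal.ofReal u₁) (ENNReal.ofReal ρ) (M k ω / ENNReal.ofReal (c k)) with hξ₀
  have hξ₀m : AEMeasurable ξ₀ P := by
    refine AEMeasurable.iSup fun k => (measurable_raise _ _).comp_aemeasurable ?_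
    refine AEMeasurable.div_const ?_ _
    exact AEMeasurable.biSup _ (hD k) fun q hq =>
      ((hX k q hq).abs).ennreal_ofReal
  have hξ₀tail : ∀ u, u₁ < u → P {ω | ENNReal.ofReal u < ξ₀ ω} ≤
      ENNReal.ofReal (2 * AU φ s θ c ε u) := by
    intro u hu
    have hu0 : 0 < u := hu₁0.trans hu
    -- If the raised value of x exceeds u > u₁, then x ≥ u₁ and x > u/ρ, so x ≥ v. This v is at
    -- least 2s and the entropy threshold, and u ≤ ρv.
    set v := max u₁ (u / ρ) with hv
    have hv0 : 0 < v := hu₁0.trans_le (le_max_left _ _)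
    set E : ℕ → Set Ω := fun k => {ω | ∀ r < v * c k, ∃ q ∈ D k, r < |X q ω|} with hE
    have hsub : {ω | ENNReal.ofReal u < ξ₀ ω} ⊆ ⋃ k, E k := by
      intro ω hω
      obtain ⟨k, hk⟩ := lt_iSup_iff.mp (show ENNReal.ofReal u < ξ₀ ω from hω)
      refine mem_iUnion.mpr ⟨k, fun r hr => ?_⟩
      obtain ⟨h1, h2⟩ := le_of_lt_raise (ENNReal.ofReal_le_ofReal hu.le) hk
      have hcpos : ENNReal.ofReal (c k) ≠ 0 := (ENNReal.ofReal_pos.mpr (hc k)).ne'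
      have h3 : ENNReal.ofReal (u / ρ) ≤ M k ω / ENNReal.ofReal (c k) := by
        rw [ENNReal.ofReal_div_of_pos hρ0]
        exact ENNReal.div_le_of_le_mul' h2.le
      have h4 : ENNReal.ofReal (v * c k) ≤ M k ω := by
        rw [ENNReal.ofReal_mul hv0.le, ← ENNReal.le_div_iff_mul_le (Or.inl hcpos)
          (Or.inl ENNReal.ofReal_ne_top)]
        rcases max_choice u₁ (u / ρ) with h | h <;> simp only [hv, h]
        · exact h1
        · exact h3
      have h5 : ENNReal.ofReal (max r 0) < M k ω := by
        refine lt_of_lt_of_le ?_ h4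
        have := mul_pos hv0 (hc k)
        exact (ENNReal.ofReal_lt_ofReal_iff this).mpr (max_lt hr this)
      obtain ⟨q, hq⟩ := lt_iSup_iff.mp h5
      obtain ⟨hqD, hq⟩ := lt_iSup_iff.mp hq
      exact ⟨q, hqD, (le_max_left _ _).trans_lt (ENNReal.ofReal_lt_ofReal_iff_of_nonneg
        (le_max_right _ _) |>.mp hq)⟩
    have hEk : ∀ k, P (E k) ≤ ENNReal.ofReal (2 * Real.exp (-youngConj φ (u / s)) *
        seriesTerm φ s θ (c k) (ε k)) := fun k => by
      have hIk : 4 / (θ * (1 - θ)) * I k ≤ v * c k := by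
        rw [← div_le_iff₀ (hc k), mul_div_assoc, mul_comm]
        refine le_trans ?_ ((le_max_right _ _).trans (le_max_left _ _))
        gcongr
        exact le_ciSup hI k
      obtain ⟨h0, h1⟩ := htail k (v * c k) (mul_pos hv0 (hc k)) hIk
      exact measure_piece_le hφ hs0 (hc k) (hε k) hρ1 (hy k) hu0
        ((le_max_left _ _).trans (le_max_left _ _))
        (by rw [← div_le_iff₀' hρ0]; exact le_max_right _ _) h0 h1
    calc P {ω | ENNReal.ofReal u < ξ₀ ω} ≤ ∑' k, P (E k) :=
          (measure_mono hsub).trans (measure_iUnion_le E)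
      _ ≤ ∑' k, ENNReal.ofReal (2 * Real.exp (-youngConj φ (u / s)) *
            seriesTerm φ s θ (c k) (ε k)) := ENNReal.tsum_le_tsum hEk
      _ = ENNReal.ofReal (2 * AU φ s θ c ε u) := by
          rw [← ENNReal.ofReal_tsum_of_nonneg (fun k => mul_nonneg (by positivity)
            (seriesTerm_nonneg _ _ _ _ _)) (hsum.mul_left _), tsum_mul_left, AU, mul_assoc]
  -- The tail bound tends to 0 because φ* tends to infinity.
  have hξ₀fin : ∀ᵐ ω ∂P, ξ₀ ω ≠ ⊤ := by
    rw [ae_iff]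
    simp only [not_not]
    refine le_antisymm ?_ zero_le
    have ht : Tendsto (fun u => ENNReal.ofReal (2 * AU φ s θ c ε u)) atTop (𝓝 0) := by
      have := ENNReal.tendsto_ofReal ((hφ.tendsto_AU hs0 θ c ε).const_mul 2)
      simpa using this
    refine ge_of_tendsto ht ?_
    filter_upwards [eventually_gt_atTop u₁] with u hu
    refine (measure_mono fun ω (hω : ξ₀ ω = ⊤) => ?_).trans (hξ₀tail u hu)
    simp [hω]
  -- The values of X are only almost everywhere measurable, so ξ is a measurable modification of ξ₀.
  refine ⟨fun ω => (hξ₀m.mk ξ₀ ω).toReal, hξ₀m.measurable_mk.ennreal_toReal, fun u hu1 hu2 => ?_, ?_⟩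
  · have hu : u₁ < u := max_lt hu1 hu2
    refine ENNReal.toReal_le_of_le_ofReal (mul_nonneg two_pos.le (AU_nonneg _ _ _ _ _ _)) ?_
    refine (measure_mono_ae ?_).trans (hξ₀tail u hu)
    filter_upwards [hξ₀m.ae_eq_mk] with ω hω h
    have h' : u < (hξ₀m.mk ξ₀ ω).toReal := h
    rw [← hω] at h'
    exact (ENNReal.ofReal_lt_iff_lt_toReal (hu₁0.trans hu).le
      (fun ht => by rw [ht, ENNReal.toReal_top] at h'; linarith)).mpr h'
  · filter_upwards [hξ₀m.ae_eq_mk, hξ₀fin, hcont] with ω hω hfin hcω k q hq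
    rw [← hω]
    have hck := hc k
    have hle : raise (ENNReal.ofReal u₁) (ENNReal.ofReal ρ) (M k ω / ENNReal.ofReal (c k)) ≤ ξ₀ ω :=
      le_iSup (fun k => raise (ENNReal.ofReal u₁) (ENNReal.ofReal ρ)
        (M k ω / ENNReal.ofReal (c k))) k
    have hlt : M k ω / ENNReal.ofReal (c k) < ξ₀ ω :=
      (lt_raise (ENNReal.ofReal_pos.mpr hu₁0) (by simpa using hρ1)
        (ne_top_of_le_ne_top hfin hle)).trans_le hle
    -- Continuity on V k extends the bound from the countable dense set D k to all of V k.
    have hqM : ENNReal.ofReal |X q ω| ≤ M k ω := by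
      have : (𝓝[D k] q).NeBot := mem_closure_iff_nhdsWithin_neBot.mp (hVD k hq)
      have ht : Tendsto (fun q => ENNReal.ofReal |X q ω|) (𝓝[D k] q)
          (𝓝 (ENNReal.ofReal |X q ω|)) :=
        ENNReal.tendsto_ofReal ((hcω k q hq).mono (hDV k)).abs
      refine le_of_tendsto ht ?_
      filter_upwards [self_mem_nhdsWithin] with q' hq'
      exact le_iSup₂ (f := fun q (_ : q ∈ D k) => ENNReal.ofReal |X q ω|) q' hq'
    have h1 : ENNReal.ofReal |X q ω| < ξ₀ ω * ENNReal.ofReal (c k) := by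
      refine hqM.trans_lt ?_
      rwa [ENNReal.div_lt_iff (Or.inl (ENNReal.ofReal_pos.mpr hck).ne')
        (Or.inl ENNReal.ofReal_ne_top)] at hlt
    rw [← ENNReal.ofReal_toReal hfin, ← ENNReal.ofReal_mul ENNReal.toReal_nonneg] at h1
    exact (ENNReal.ofReal_lt_ofReal_iff_of_nonneg (abs_nonneg _)).mp h1

end Majorant

end PhiSub

/-! ### The main theorem -/

theorem mainTheorem3
    {Ω : Type*} [MeasurableSpace Ω] (P : Measure Ω) [IsProbabilityMeasure P]
    -- the N-function, and the admissible function `Z`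
    (φ : ℝ → ℝ) (hφ : IsNFunction φ) (hQ : ConditionQ φ)
    (Z : ℝ → ℝ) (u₀ : ℝ) (hZ : IsAdmissible φ Z u₀)
    -- the strictly `φ`-sub-Gaussian process `y`, its covariance function having finite variation
    (y : ℝ → Ω → ℝ) (Cy : ℝ) (hy : IsStrictlySub φ P y Cy)
    (hΓ : FiniteVariation (covFun P y))
    -- the kernel and the field `U(t, x) = ∫ I(t, x, l) dy(l)`, continuous with probability one
    (κ : ℝ → ℝ) (hκ : κ = Real.cos ∨ κ = Real.sin) (N : ℕ) (a : ℕ → ℝ)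
    (A : ℝ) (hA : 0 < A) (U : ℝ → ℝ → Ω → ℝ)
    (hU : ∀ x ∈ Set.Icc (-A) A, ∀ t ∈ Set.Ici (0 : ℝ),
      HasMSIntegral P y (kernelI κ N a t x) (U t x))
    (hUcont : ∀ᵐ ω ∂P, ContinuousOn (fun q : ℝ × ℝ => U q.2 q.1 ω)
      (Set.Icc (-A) A ×ˢ Set.Ici (0 : ℝ)))
    -- the integral `C_Z²` converges
    (hCZ : CZsq (covFun P y) Z u₀ N a ≠ ⊤)
    -- 1. the segments `[b_k, b_{k+1}]`
    (b : ℕ → ℝ) (hb0 : b 0 = 0) (hb : ∀ k, 2 * A ≤ b (k + 1) - b k)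
    -- 2. the function `c`
    (c : ℝ → ℝ) (hc : ContinuousOn c (Set.Ici 0)) (hcpos : ∀ t, 0 ≤ t → 0 < c t)
    -- 3. `sup_k ε_k / c_k < ∞`
    (hε : BddAbove (Set.range fun k => eps P U Cy A b k / cmin c b k))
    -- 4. `sup_k Î_{φ,k}(θ ε_k) / c_k < ∞`
    (θ : ℝ) (hθ0 : 0 < θ) (hθ1 : θ < 1)
    (hI : BddAbove (Set.range fun k =>
      Ihat φ Z u₀ (CZ (covFun P y) Z u₀ N a) Cy A b k (θ * eps P U Cy A b k) / cmin c b k))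
    -- 5. the series converges for the number `s`
    (s : ℝ) (hs : (⨆ k, 4 * eps P U Cy A b k / (cmin c b k * (1 - θ))) < s)
    (hsum : Summable fun k => seriesTerm φ s θ (cmin c b k) (eps P U Cy A b k)) :
    ∃ ξ : Ω → ℝ, Measurable ξ ∧
      (∀ u : ℝ, 2 * s < u →
        (⨆ k, Ihat φ Z u₀ (CZ (covFun P y) Z u₀ N a) Cy A b k (θ * eps P U Cy A b k) /
          cmin c b k) * (4 / (θ * (1 - θ))) < u →
        P.real {ω | u < ξ ω} ≤ 2 * AU φ s θ (cmin c b) (eps P U Cy A b) u) ∧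
      ∀ᵐ ω ∂P, ∀ x ∈ Set.Icc (-A) A, ∀ t ∈ Set.Ici (0 : ℝ), |U t x ω| < ξ ω * c t := by
  have hL : ∀ u, MemLp (y u) 2 P := fun u => (hy.1 u).memLp
  have hbmono : Monotone b := monotone_nat_of_le_succ fun k => by linarith [hb k]
  have hb_nonneg : ∀ k, 0 ≤ b k := fun k => hb0 ▸ hbmono k.zero_le
  have hVsub : ∀ k, Icc (-A) A ×ˢ Icc (b k) (b (k + 1)) ⊆ Icc (-A) A ×ˢ Ici (0 : ℝ) := fun k =>
    prod_mono le_rfl fun t ht => (hb_nonneg k).trans ht.1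
  set X : ℝ × ℝ → Ω → ℝ := fun q => U q.2 q.1 with hX
  have hint : ∀ q ∈ Icc (-A) A ×ˢ Ici (0 : ℝ), HasMSIntegral P y (kernelI κ N a q.2 q.1) (X q) :=
    fun q hq => hU q.1 hq.1 q.2 hq.2
  have hcl : ∀ q ∈ Icc (-A) A ×ˢ Ici (0 : ℝ), MemMSClosure P y (X q) := fun q hq =>
    (hint q hq).memMSClosure hL
  have hcpos' : ∀ k, 0 < cmin c b k ∧ ∀ t ∈ Icc (b k) (b (k + 1)), cmin c b k ≤ c t := fun k => by
    have hsub : Icc (b k) (b (k + 1)) ⊆ Ici 0 := fun t ht => (hb_nonneg k).trans ht.1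
    have hcpt := isCompact_Icc.image_of_continuousOn (hc.mono hsub)
    have hne : (c '' Icc (b k) (b (k + 1))).Nonempty :=
      (nonempty_Icc.mpr (hbmono k.le_succ)).image c
    refine ⟨?_, fun t ht => csInf_le hcpt.bddBelow (mem_image_of_mem c ht)⟩
    obtain ⟨t, ht, h⟩ := hcpt.sInf_mem hne
    rw [cmin, ← h]
    exact hcpos t (hsub ht)
  choose D hDV hDc hVD using fun k => (TopologicalSpace.IsSeparable.of_separableSpace
    (Icc (-A) A ×ˢ Icc (b k) (b (k + 1)))).exists_countable_dense_subset
  have hfield := fun k => field_rectangle_bound (Cy := Cy) (CZ := CZ (covFun P y) Z u₀ N a)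
    (ε := eps P U Cy A b k) hφ hZ hA.le (hbmono k.le_succ)
    (Real.sqrt_nonneg _) hθ0 hθ1 X (hDc k) (hDV k) (fun q hq => (hcl q (hVsub k hq)).1)
    (fun q hq => hy.expBound hφ (hcl q (hVsub k hq)))
    (fun q hq q' hq' => (hy.expBound hφ ((hcl q (hVsub k hq)).sub hy (hcl q' (hVsub k hq')))).2)
    (fun w hw hZw q hq q' hq' h1 h2 =>
      (hint q (hVsub k hq)).sqrt_integral_sub_sq_le hL hΓ (hint q' (hVsub k hq'))
        (hZ.continuous_weight N a) hCZ (by positivity)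
        (hZ.abs_kernelI_sub_le hκ N a hw hZw h1 h2))
    (hUcont.mono fun ω hω => hω.mono (hVsub k)) rfl
  obtain ⟨ξ, hξm, hξtail, hξ⟩ := exists_majorant hφ X
    (fun k => Icc (-A) A ×ˢ Icc (b k) (b (k + 1))) D hDc hDV hVD
    (fun k q hq => (hcl q (hVsub k (hDV k hq))).1.1.aemeasurable)
    (hUcont.mono fun ω hω k => hω.mono (hVsub k)) (fun k => (hcpos' k).1)
    (fun k => (hfield k).1) hθ0 hθ1 hε hI hs hsum (fun k => (hfield k).2)
  refine ⟨ξ, hξm, hξtail, ?_⟩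
  filter_upwards [hξ] with ω hω x hx t ht
  obtain ⟨k, hk⟩ := exists_mem_Icc_of_unbounded (show 0 < 2 * A by linarith) hb0 hb ht
  have h1 := hω k (x, t) ⟨hx, hk⟩
  -- Positivity of ξ, needed to pass from c_k to c(t) ≥ c_k, is read off from |U| < ξ c_k.
  have h2 : 0 < ξ ω := pos_of_mul_pos_left ((abs_nonneg _).trans_lt h1) (hcpos' k).1.le
  exact h1.trans_le (mul_le_mul_of_nonneg_left ((hcpos' k).2 t hk) h2.le)
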